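/- **Lifting structures.** Let $\mathcal C$ be a category with pullbacks and $m : J \to \mathcal C^{\to}$ a functor from a category $J$ (the generating left maps $m_j : A_j \to B_j$, with the squares between them). A *lifting structure* on a map $f : X \to Y$ against $m$ is a choice, for all $j \in J$ and all commutative squares $m_j \to f$, of a diagonal filler $B_j \to X$, natural in $j$. If $f' \to f$ is a pullback square, a lifting structure on $f$ induces one on $f'$. In particular it can be restricted along any $\tau : Y' \to Y$ to a lifting structure on $\tau^* f$. Maps with a lifting structure form a category $m^{\pitchfork}$ (morphisms are the squares that commute with the chosen fillers), and the forgetful functor $\chi_m : m^{\pitchfork} \to \mathcal C^{\to}$ is a notion of structure on the codomain fibration $\mathrm{cod} : \mathcal C^{\to} \to \mathcal C$: it is a fibred functor whose restriction $\mathrm{Cart}(\chi_m) : \mathrm{Cart}(m^{\pitchfork}) \to \mathrm{Cart}(\mathcal C^{\to})$ to cartesian morphisms is a discrete fibration. It is the notion of structure underlying the awfs cofibrantly generated by $m$. It (or this awfs) is called *definable* if $\mathrm{Cart}(\chi_m)$ has a right adjoint (as an ordinary functor). A vertical map $g$ of $\mathcal C/I$ is used as a generating family through all its reindexings: $J = \mathcal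 C/I$, $m_\sigma = \sigma^* g$ for $\sigma : U \to I$ ("fibred lifting against $g$"). A set-indexed family is used with $J$ discrete. **Kan fibration structures.** Given two endpoint inclusions $\delta_0,\delta_1$ and a generating family $m$, consider the generating family of all pushout products $\delta_i \mathbin{\hat\times} m_j$, $i\in\{0,1\}$, $j \in J$. In a topos $\mathcal C$ with an object $\mathbb I$ with endpoints $\delta_0,\delta_1 : 1 \to \mathbb I$, a *Kan fibration structure* on $f$ is a lifting structure against this family for $m$ the subobject classifier $1 \to \Omega$, as a vertical map over $\Omega$ (so, up to isomorphism, $m$ consists of all monomorphisms, with reindexing). **Part 1.** Let $\mathcal C$ be an elementary topos, with finite limits and colimits, and let $(\mathbb I, \le, 0, 1)$ be an internal linear order (reflexive, transitive, antisymmetric, and $\mathbb I\times\mathbb I$ is the union of $\{x\le y\}$ and $\{x \ge y\}$) with least element $0$ and greatest element $1$, such that the endpoint map $2 = 1 + 1 \to \mathbb I$ is not a regular epimorphism. Let $T_0 = \{(x,y) \mid x \ge y\}$ and $T_1 = \{(x,y)\mid x \le y\}$, as subobjects of $\mathbb I \times \mathbb I$, and let $Z \to \mathbb I \times \mathbb I$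 be the family $Z_{x,y} = \{\varphi \in \Omega \mid x \ge y \to \varphi\}$. Then there are two different Kan fibration structures on $Z \to \mathbb I \times \mathbb I$ whose restrictions to $T_0$ are equal and whose restrictions to $T_1$ are equal. **Part 2.** In the category of simplicial sets, with the endpoint inclusions $\Delta_0 \rightrightarrows \Delta_1$, the notions of structure (awfs's) cofibrantly generated by the following families are not definable: 1. pushout products of the endpoint inclusions with monomorphisms, i.e. with $1 \to \Omega$ over $\Omega$ and all its reindexings; 2. pushout products of the endpoint inclusions with locally (i.e. levelwise) decidable monomorphisms, i.e. with the restriction of $1 \to \Omega$ to the subobject $\Omega_{\mathrm{dec}} \subseteq \Omega$ of locally decidable truth values, and all its reindexings; 3. pushout products of the endpoint inclusions with the set of all subobjects $A \hookrightarrow \Delta_n$ of representables; 4. pushout products of the endpoint inclusions with the set of all boundary inclusions $\partial\Delta_n \hookrightarrow \Delta_n$, $n \ge 0$; 5. the coproduct of all horn inclusions $\Lambda^n_k \hookrightarrow \Delta_n$, $n \ge 1$, $0 \le k \le n$, as a vertical map over the coproduct $\coprod_{(n,k)} 1$, with all its reindexings (fibred lifting with respect to the codomain fibration). The same holds for enriched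 lifting structures against the horn inclusions for the cartesian monoidal product, that is, for fillers of all squares against the maps $U \times \Lambda^n_k \to U \times \Delta_n$, natural in $U$. -/

import Mathlib

open CategoryTheory Limits MonoidalCategory CartesianMonoidalCategory
open scoped Simplicial

universe v₁ v₂ v₃ u₁ u₂ u₃ v u w

noncomputable section

namespace Definability

/-! ### Fibrations, notions of structure, definability -/

section Fibrations

variable {B : Type u₁} [Category.{v₁} B] {E : Type u₂} [Category.{v₂} E]

/-- The class of cartesian morphisms of `E` with respect to `p : E ⥤ B`. -/
def cartesian (p : E ⥤ B) : MorphismProperty E :=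
  fun _ _ φ => p.IsStronglyCartesian (p.map φ) φ

instance (p : E ⥤ B) : (cartesian p).IsMultiplicative where
  id_mem X := by
    unfold cartesian
    infer_instance
  comp_mem φ ψ hφ hψ := by
    unfold cartesian at *
    rw [Functor.map_comp]
    infer_instance

/-- `Cart(E)`: the wide subcategory of `E` on the morphisms that are cartesian for `p`. -/
abbrev Cart (p : E ⥤ B) := WideSubcategory (cartesian p)

/-- The restriction of `χ : D ⥤ E` to cartesian morphisms, for `χ` over `B` preserving them. -/
@[simps]
def cartMap {D : Type u₃} [Category.{v₃} D] (p : D ⥤ B) (q : E ⥤ B) (χ : D ⥤ E)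
    (h : ∀ ⦃X Y : D⦄ (φ : X ⟶ Y), cartesian p φ → cartesian q (χ.map φ)) :
    Cart p ⥤ Cart q where
  obj X := ⟨χ.obj X.obj⟩
  map φ := ⟨χ.map φ.hom, h _ φ.property⟩

/-- `F` is a discrete fibration: each morphism into `F Y` has exactly one lift to a morphism
with codomain `Y`. -/
def IsDiscreteFibration {D : Type u₃} [Category.{v₃} D] (F : D ⥤ E) : Prop :=
  ∀ (Y : D) (φ : Over (F.obj Y)), ∃! ψ : Over Y, (Over.post F).obj ψ = φ

/-- A (fibred) notion of structure on `q : E ⥤ B`: a fibration `p` over `B` together with a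
fibred functor `χ` from `p` to `q` over `B` which creates cartesian lifts, that is, whose
restriction `Cart(χ)` to cartesian morphisms is a discrete fibration. -/
structure NotionOfStructure (q : E ⥤ B) where
  /-- the category of structured objects -/
  D : Type u₃
  /-- morphisms of structured objects -/
  [cat : Category.{v₃} D]
  /-- the projection to the base -/
  p : D ⥤ B
  /-- the functor forgetting structure -/
  χ : D ⥤ E
  comm : χ ⋙ q = p
  isFibered : p.IsFibered
  preserves : ∀ ⦃X Y : D⦄ (φ : X ⟶ Y), cartesian p φ → cartesian q (χ.map φ)
  creates : IsDiscreteFibration (cartMap p q χ preserves)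

attribute [instance] NotionOfStructure.cat

/-- A notion of structure `χ` is definable if `Cart(χ)` has a right adjoint (as an ordinary
functor between categories). -/
def NotionOfStructure.Definable {q : E ⥤ B} (N : NotionOfStructure.{v₁, v₂, v₃, u₁, u₂, u₃} q) :
    Prop :=
  (cartMap N.p q N.χ N.preserves).IsLeftAdjoint

end Fibrations

/-! ### Lifting structures -/

section Lifting

variable {C : Type u} [Category.{v} C] {J : Type u₁} [Category.{v₁} J]

/-- A lifting structure on `f` against a diagram `m : J ⥤ Arrow C` of generating left maps: a
choice of diagonal filler for every commutative square from some `m j` to `f`, natural in `j`.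
For `J` discrete this is a choice of fillers for all lifting problems against a set of maps.
For `m = reindex g` with `g` a vertical map of the codomain fibration over `I` (see below), it
is a choice of filler, for every `σ : U ⟶ I`, of every lifting problem of `σ^* g` against `f`,
stable under reindexing; by the universal property of the hom objects of the codomain fibration
this is a section of `hom(B, X) ⟶ hom(A, X) ×_{hom(A, Y)} hom(B, Y)`. -/
@[ext]
structure LiftingStructure (m : J ⥤ Arrow C) (f : Arrow C) where
  /-- the chosen filler -/
  fill : ∀ (j : J) (_ : m.obj j ⟶ f), (m.obj j).right ⟶ f.left
  fac_left : ∀ (j : J) (sq : m.obj j ⟶ f), (m.obj j).hom ≫ fill j sq = sq.left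
  fac_right : ∀ (j : J) (sq : m.obj j ⟶ f), fill j sq ≫ f.hom = sq.right
  natural : ∀ {j j' : J} (k : j ⟶ j') (sq : m.obj j' ⟶ f),
    fill j (m.map k ≫ sq) = (m.map k).right ≫ fill j' sq

variable {m : J ⥤ Arrow C}

/-- The lifting structure induced on `f` by one on `g`, for a cartesian square `φ : f ⟶ g`. -/
def LiftingStructure.restrict {f g : Arrow C} (t : LiftingStructure m g) (φ : f ⟶ g)
    (h : IsPullback φ.left f.hom g.hom φ.right) : LiftingStructure m f where
  fill j sq := h.lift (t.fill j (sq ≫ φ)) sq.right (by simp [t.fac_right])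
  fac_left j sq := h.hom_ext (by simp [t.fac_left]) (by simp)
  fac_right j sq := by simp
  natural k sq := h.hom_ext (by simp [t.natural]) (by simp)

/-- The pullback of a lifting structure on `f` along a morphism `τ` into the codomain of `f`. -/
def LiftingStructure.reindex [HasPullbacks C] {f : Arrow C} (t : LiftingStructure m f) {Y : C}
    (τ : Y ⟶ f.right) : LiftingStructure m (Arrow.mk (pullback.snd f.hom τ)) :=
  t.restrict (Arrow.homMk (pullback.fst f.hom τ) τ pullback.condition)
    (IsPullback.of_hasPullback f.hom τ)

variable (m) in
/-- Maps equipped with a lifting structure against `m` (the objects of `m^⋔`). -/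
structure RightMap where
  /-- the underlying map -/
  arrow : Arrow C
  /-- the lifting structure -/
  str : LiftingStructure m arrow

/-- Morphisms of `m^⋔`: commutative squares commuting with the chosen fillers. -/
@[ext]
structure RightMap.Hom (X Y : RightMap m) where
  /-- the underlying square -/
  sq : X.arrow ⟶ Y.arrow
  comm : ∀ (j : J) (s : m.obj j ⟶ X.arrow),
    X.str.fill j s ≫ sq.left = Y.str.fill j (s ≫ sq)

instance : Category (RightMap m) where
  Hom := RightMap.Hom
  id X := ⟨𝟙 _, by simp⟩
  comp φ ψ := ⟨φ.sq ≫ ψ.sq, fun j s => by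
    have h := φ.comm j s
    simp only [Arrow.comp_left]
    rw [reassoc_of% h, ψ.comm, Category.assoc]⟩

@[ext]
lemma RightMap.hom_ext {X Y : RightMap m} {φ ψ : X ⟶ Y} (h : φ.sq = ψ.sq) : φ = ψ :=
  RightMap.Hom.ext h

variable (m) in
/-- The functor forgetting lifting structures. -/
@[simps]
def RightMap.forget : RightMap m ⥤ Arrow C where
  obj X := X.arrow
  map φ := φ.sq

end Lifting

/-! ### Lifting structures form a notion of structure on the codomain fibration -/

section LiftingNotion

lemma cartesian_iff {B : Type u₁} [Category.{v₁} B] {E : Type u₂} [Category.{v₂} E] (p : E ⥤ B)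
    {X Y : E} (φ : X ⟶ Y) :
    cartesian p φ ↔ ∀ (Z : E) (g : p.obj Z ⟶ p.obj X) (ψ : Z ⟶ Y), p.map ψ = g ≫ p.map φ →
      ∃! χ : Z ⟶ X, p.map χ = g ∧ χ ≫ φ = ψ := by
  have key : ∀ {Z W : E} (g : p.obj Z ⟶ p.obj W) (χ : Z ⟶ W),
      p.IsHomLift g χ ↔ p.map χ = g := by
    intro Z W g χ
    constructor
    · intro h
      exact (IsHomLift.eq_of_isHomLift p g χ).symm
    · rintro rfl
      infer_instance
  constructor
  · intro h Z g ψ hψ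
    have h' : p.IsStronglyCartesian (p.map φ) φ := h
    have hl : p.IsHomLift (g ≫ p.map φ) ψ := (key _ _).2 hψ
    simpa only [key] using h'.universal_property' g ψ
  · intro h
    refine Functor.IsStronglyCartesian.mk ?_
    intro Z g ψ hl
    simpa only [key] using h Z g ψ ((key _ _).1 hl)

variable {C : Type u} [Category.{v} C]

/-- The cartesian morphisms of the codomain fibration are the pullback squares. -/
lemma cartesian_rightFunc_iff {f g : Arrow C} (φ : f ⟶ g) :
    cartesian Arrow.rightFunc φ ↔ IsPullback φ.left f.hom g.hom φ.right := by
  have iff₁ : cartesian Arrow.rightFunc φ ↔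
      ∀ (Z : Arrow C) (k : Z.right ⟶ f.right) (ψ : Z ⟶ g), ψ.right = k ≫ φ.right →
        ∃! χ : Z ⟶ f, χ.right = k ∧ χ ≫ φ = ψ := cartesian_iff _ _
  rw [iff₁]
  constructor
  · intro h
    have key : ∀ {W : C} (x : W ⟶ g.left) (y : W ⟶ f.right), x ≫ g.hom = y ≫ φ.right →
        ∃! l : W ⟶ f.left, l ≫ φ.left = x ∧ l ≫ f.hom = y := by
      intro W x y hxy
      obtain ⟨χ, ⟨h₁, h₂⟩, h₃⟩ := h (Arrow.mk y) (𝟙 _)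
        (Arrow.homMk x (φ.right) hxy) (by simp)
      refine ⟨χ.left, ⟨by simpa using congrArg (fun t => CommaMorphism.left t) h₂, ?_⟩, ?_⟩
      · have := Arrow.w χ
        rw [h₁] at this
        simpa using this
      · rintro l ⟨hl₁, hl₂⟩
        have := h₃ (Arrow.homMk l (𝟙 _) (by simpa using hl₂))
          ⟨rfl, by ext <;> simp [hl₁]⟩
        simpa using congrArg (fun t => CommaMorphism.left t) this
    refine ⟨⟨by simp⟩, ⟨PullbackCone.IsLimit.mk _
      (fun s => (key s.fst s.snd s.condition).choose)
      (fun s => (key s.fst s.snd s.condition).choose_spec.1.1)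
      (fun s => (key s.fst s.snd s.condition).choose_spec.1.2)
      (fun s l h₁ h₂ => (key s.fst s.snd s.condition).choose_spec.2 l ⟨h₁, h₂⟩)⟩⟩
  · intro h Z k ψ hψ
    refine ⟨Arrow.homMk (h.lift ψ.left (Z.hom ≫ k) (by simp [hψ])) k (by simp), ⟨rfl, ?_⟩, ?_⟩
    · ext <;> simp [hψ]
    · rintro χ ⟨rfl, rfl⟩
      ext
      · exact h.hom_ext (by simp) (by simp)
      · simp

variable {J : Type u₁} [Category.{v₁} J] (m : J ⥤ Arrow C)

lemma RightMap.cartesian_iff {X Y : RightMap m} (φ : X ⟶ Y) :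
    cartesian (RightMap.forget m ⋙ Arrow.rightFunc) φ ↔
      ∀ (Z : RightMap m) (k : Z.arrow.right ⟶ X.arrow.right) (ψ : Z ⟶ Y),
        ψ.sq.right = k ≫ φ.sq.right → ∃! χ : Z ⟶ X, χ.sq.right = k ∧ χ ≫ φ = ψ :=
  Definability.cartesian_iff _ _

@[simp]
lemma RightMap.comp_sq {X Y Z : RightMap m} (φ : X ⟶ Y) (ψ : Y ⟶ Z) :
    (φ ≫ ψ).sq = φ.sq ≫ ψ.sq := rfl

@[simp]
lemma RightMap.id_sq (X : RightMap m) : RightMap.Hom.sq (𝟙 X) = 𝟙 X.arrow := rfl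

lemma RightMap.cartesian_of_isPullback {X Y : RightMap m} (φ : X ⟶ Y)
    (h : IsPullback φ.sq.left X.arrow.hom Y.arrow.hom φ.sq.right) :
    cartesian (RightMap.forget m ⋙ Arrow.rightFunc) φ := by
  rw [RightMap.cartesian_iff]
  intro Z k ψ hψ
  let χ : Z.arrow ⟶ X.arrow :=
    Arrow.homMk (h.lift ψ.sq.left (Z.arrow.hom ≫ k) (by simp [hψ])) k (by simp)
  have hχ : χ ≫ φ.sq = ψ.sq := by
    ext <;> simp [χ, hψ]
  have hχ' : χ.left ≫ φ.sq.left = ψ.sq.left := by simp [χ]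
  refine ⟨⟨χ, fun j s => h.hom_ext ?_ ?_⟩, ⟨rfl, RightMap.hom_ext hχ⟩, ?_⟩
  · rw [φ.comm, Category.assoc, Category.assoc, hχ, ← ψ.comm, hχ']
  · rw [X.str.fac_right]
    simp [χ, reassoc_of% (Z.str.fac_right j s)]
  · rintro χ' ⟨rfl, rfl⟩
    ext
    · exact h.hom_ext (by simp [χ]) (by simp [χ])
    · simp [χ]

/-- The cartesian lift of a pullback square to structured maps. -/
def RightMap.lift {f : Arrow C} {Y : RightMap m} (φ : f ⟶ Y.arrow)
    (h : IsPullback φ.left f.hom Y.arrow.hom φ.right) :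
    (⟨f, Y.str.restrict φ h⟩ : RightMap m) ⟶ Y :=
  ⟨φ, fun j s => by simp [LiftingStructure.restrict]⟩

lemma RightMap.isPullback_of_cartesian [HasPullbacks C] {X Y : RightMap m} (φ : X ⟶ Y)
    (h : cartesian (RightMap.forget m ⋙ Arrow.rightFunc) φ) :
    IsPullback φ.sq.left X.arrow.hom Y.arrow.hom φ.sq.right := by
  let sq : Arrow.mk (pullback.snd Y.arrow.hom φ.sq.right) ⟶ Y.arrow :=
    Arrow.homMk (pullback.fst Y.arrow.hom φ.sq.right) φ.sq.right pullback.condition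
  have hsq : IsPullback sq.left _ Y.arrow.hom sq.right :=
    IsPullback.of_hasPullback Y.arrow.hom φ.sq.right
  let ψ := RightMap.lift m sq hsq
  have hψ := RightMap.cartesian_of_isPullback m ψ hsq
  rw [RightMap.cartesian_iff] at h hψ
  obtain ⟨a, ⟨ha₁, ha₂⟩, -⟩ := hψ X (𝟙 _) φ (Category.id_comp _).symm
  obtain ⟨b, ⟨hb₁, hb₂⟩, -⟩ := h ⟨_, Y.str.restrict sq hsq⟩ (𝟙 _) ψ (Category.id_comp _).symm
  have hab : a ≫ b = 𝟙 X := (h X (𝟙 _) φ (Category.id_comp _).symm).unique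
    ⟨by rw [RightMap.comp_sq, Arrow.comp_right, ha₁, hb₁]; exact Category.comp_id _,
      by simp [ha₂, hb₂]⟩
    ⟨by simp, by simp⟩
  have hba : b ≫ a = 𝟙 _ := (hψ ⟨_, Y.str.restrict sq hsq⟩ (𝟙 _) ψ (Category.id_comp _).symm).unique
    ⟨by rw [RightMap.comp_sq, Arrow.comp_right, ha₁, hb₁]; exact Category.comp_id _,
      by simp [ha₂, hb₂]⟩
    ⟨by simp, by simp⟩
  let e : X ≅ _ := ⟨a, b, hab, hba⟩
  let e' := (RightMap.forget m).mapIso e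
  have hl : IsIso a.sq.left := inferInstanceAs (IsIso (Arrow.leftFunc.mapIso e').hom)
  have hr : IsIso a.sq.right := inferInstanceAs (IsIso (Arrow.rightFunc.mapIso e').hom)
  have h₁ : IsPullback a.sq.left X.arrow.hom _ a.sq.right :=
    IsPullback.of_horiz_isIso ⟨Arrow.w a.sq⟩
  have := h₁.paste_horiz hsq
  have h₂ : a.sq ≫ sq = φ.sq := congrArg RightMap.Hom.sq ha₂
  rw [← h₂]
  simpa using this

/-- The lifting notion of structure generated by `m`, on the codomain fibration. When the
forgetful functor is monadic, this is the notion of structure of right maps of the awfs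
cofibrantly generated by `m`. -/
def liftingNotion [HasPullbacks C] : NotionOfStructure (Arrow.rightFunc : Arrow C ⥤ C) where
  D := RightMap m
  p := RightMap.forget m ⋙ Arrow.rightFunc
  χ := RightMap.forget m
  comm := rfl
  isFibered := Functor.IsFibered.of_exists_isStronglyCartesian (fun Y R f => by
    let f' : R ⟶ Y.arrow.right := f
    let sq : Arrow.mk (pullback.snd Y.arrow.hom f') ⟶ Y.arrow :=
      Arrow.homMk (pullback.fst Y.arrow.hom f') f' pullback.condition
    have hsq : IsPullback sq.left (Arrow.mk (pullback.snd Y.arrow.hom f')).hom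
        Y.arrow.hom sq.right := IsPullback.of_hasPullback Y.arrow.hom f'
    have := RightMap.cartesian_of_isPullback m (RightMap.lift m sq hsq) hsq
    exact ⟨_, RightMap.lift m sq hsq, this⟩)
  preserves X Y φ hφ := (cartesian_rightFunc_iff _).2 (RightMap.isPullback_of_cartesian m φ hφ)
  creates := by
    rintro ⟨Y⟩ φ
    have hφ : IsPullback φ.hom.hom.left φ.left.obj.hom Y.arrow.hom φ.hom.hom.right :=
      (cartesian_rightFunc_iff _).1 φ.hom.property
    refine ⟨Over.mk (Y := (⟨⟨φ.left.obj, Y.str.restrict φ.hom.hom hφ⟩⟩ : Cart _))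
      ⟨RightMap.lift m φ.hom.hom hφ, RightMap.cartesian_of_isPullback m _ hφ⟩, rfl, ?_⟩
    rintro ⟨⟨⟨f, s⟩⟩, ⟨⟨⟩⟩, ⟨⟨sq, c⟩, hc⟩⟩ rfl
    change f ⟶ Y.arrow at sq
    have hsq : IsPullback sq.left f.hom Y.arrow.hom sq.right := hφ
    have hs : s = Y.str.restrict sq hsq := by
      ext j t
      apply hsq.hom_ext
      · simpa [LiftingStructure.restrict] using c j t
      · exact (s.fac_right j t).trans (by simp [LiftingStructure.restrict])
    let l : (⟨⟨f, Y.str.restrict sq hsq⟩⟩ : Cart (RightMap.forget m ⋙ Arrow.rightFunc)) ⟶ ⟨Y⟩ :=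
      ⟨RightMap.lift m sq hsq, RightMap.cartesian_of_isPullback m _ hsq⟩
    change _ = Over.mk l
    clear hφ
    subst hs
    rfl

end LiftingNotion

/-! ### Generating families of left maps -/

section Generators

variable {C : Type u} [Category.{v} C]

/-- A morphism `g : X ⟶ Y` of `C / I`, that is, a vertical map of the codomain fibration over
`I`, viewed through all its reindexings: the diagram sending `σ : U ⟶ I` to
`σ^* g : X ×_I U ⟶ Y ×_I U`. Lifting structures against it are fibred lifting structures
against `g`. -/
@[simps]
def reindex [HasPullbacks C] {I : C} {X Y : Over I} (g : X ⟶ Y) : Over I ⥤ Arrow C where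
  obj σ := Arrow.mk (pullback.map X.hom σ.hom Y.hom σ.hom g.left (𝟙 _) (𝟙 _)
    (by simp) (by simp))
  map τ := Arrow.homMk
    (pullback.map _ _ _ _ (𝟙 _) τ.left (𝟙 _) (by simp) (by simp))
    (pullback.map _ _ _ _ (𝟙 _) τ.left (𝟙 _) (by simp) (by simp))
    (by apply pullback.hom_ext <;> simp [pullback.map, pullback.lift_fst_assoc,
      pullback.lift_snd_assoc, pullback.lift_fst, pullback.lift_snd])
  map_id σ := by
    ext <;> apply pullback.hom_ext <;> simp [pullback.map, pullback.lift_fst, pullback.lift_snd]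
  map_comp τ τ' := by
    ext <;> apply pullback.hom_ext <;> simp [pullback.map, pullback.lift_fst, pullback.lift_snd,
      pullback.lift_snd_assoc]

/-- The generating left maps for Kan fibrations: the pushout products `δ i □ m j` of the two
endpoint inclusions `δ 0`, `δ 1` with the members of a diagram `m` of monomorphisms. -/
def kanMaps [HasPushouts C] [MonoidalCategory C] (δ : Fin 2 → Arrow C)
    {J : Type u₁} [Category.{v₁} J] (m : J ⥤ Arrow C) : Discrete (Fin 2) × J ⥤ Arrow C :=
  Functor.uncurry.obj (Discrete.functor fun i => m ⋙ Arrow.pushoutProduct.obj (δ i))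

/-- The generic monomorphism `truth : 1 ⟶ Ω`, as a vertical map over `Ω`, with all its
reindexings (up to isomorphism, these are all the monomorphisms of `C`). -/
def genericMono (C : Type u) [Category.{v} C] [HasPullbacks C] [HasSubobjectClassifier C] :
    Over (HasSubobjectClassifier.Ω C) ⥤ Arrow C :=
  reindex (X := Over.mk (HasSubobjectClassifier.truth C))
    (Y := Over.mk (𝟙 (HasSubobjectClassifier.Ω C)))
    (Over.homMk (HasSubobjectClassifier.truth C))

/-- A set-indexed family of maps. -/
def setFamily {ι : Type w} (g : ι → Arrow C) : Discrete ι ⥤ Arrow C := Discrete.functor g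

/-- The coproduct of a set-indexed family of maps `A i ⟶ B i`, as a vertical map of the codomain
fibration over the coproduct `∐ 1` of copies of the terminal object, with all its reindexings. -/
def fibredCoproduct [HasPullbacks C] [CartesianMonoidalCategory C] {ι : Type w}
    [HasColimitsOfShape (Discrete ι) C] (g : ι → Arrow C) :
    Over (∐ fun _ : ι => 𝟙_ C) ⥤ Arrow C :=
  reindex
    (X := Over.mk (Limits.Sigma.map fun i => toUnit (g i).left))
    (Y := Over.mk (Limits.Sigma.map fun i => toUnit (g i).right))
    (Over.homMk (Limits.Sigma.map fun i => (g i).hom)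
      (by apply Limits.Sigma.hom_ext; intro i; simp))

/-- The maps `U × A i ⟶ U × B i` for a set-indexed family `A i ⟶ B i`, natural in `U`. Lifting
structures against these are, by transposition, families of sections of the maps
`X ^ B i ⟶ X ^ A i ×_{Y ^ A i} Y ^ B i`, i.e. enriched lifting structures for the cartesian
monoidal product. -/
def enrichedMaps [MonoidalCategory C] {ι : Type w} (g : ι → Arrow C) :
    Discrete ι × C ⥤ Arrow C :=
  Functor.uncurry.obj (Discrete.functor fun i =>
    { obj := fun U => Arrow.mk (U ◁ (g i).hom)
      map := fun τ => Arrow.homMk (τ ▷ (g i).left) (τ ▷ (g i).right)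
        (by simp [whisker_exchange]) })

end Generators

/-! ### Linear intervals in a topos -/

section Interval

variable (C : Type u) [Category.{v} C] [CartesianMonoidalCategory C] [HasFiniteCoproducts C]

/-- An internal linear order with endpoints `(𝕀, ≤, 0, 1)`. The order relation is a subobject
`le` of `𝕀 × 𝕀`; the axioms of a partial order and those for the endpoints are stated for
generalised elements. Totality, `x ≤ y ∨ y ≤ x`, says that `𝕀 × 𝕀` is the union of the
subobjects `{x ≤ y}` and `{x ≥ y}`, i.e. that these are jointly epimorphic. -/
structure LinearInterval where
  /-- the underlying object -/
  I : C
  /-- the object of pairs `(x, y)` with `x ≤ y` -/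
  R : C
  /-- the inclusion of `{(x, y) | x ≤ y}` -/
  le : R ⟶ I ⊗ I
  [mono_le : Mono le]
  /-- the endpoint `0` -/
  zero : 𝟙_ C ⟶ I
  /-- the endpoint `1` -/
  one : 𝟙_ C ⟶ I
  le_refl : ∀ {U : C} (x : U ⟶ I), ∃ k : U ⟶ R, k ≫ le = lift x x
  le_trans : ∀ {U : C} (x y z : U ⟶ I), (∃ k : U ⟶ R, k ≫ le = lift x y) →
    (∃ k : U ⟶ R, k ≫ le = lift y z) → ∃ k : U ⟶ R, k ≫ le = lift x z
  le_antisymm : ∀ {U : C} (x y : U ⟶ I), (∃ k : U ⟶ R, k ≫ le = lift x y) →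
    (∃ k : U ⟶ R, k ≫ le = lift y x) → x = y
  le_total : Epi (coprod.desc le (le ≫ lift (snd I I) (fst I I)))
  zero_le : ∀ {U : C} (x : U ⟶ I), ∃ k : U ⟶ R, k ≫ le = lift (toUnit U ≫ zero) x
  le_one : ∀ {U : C} (x : U ⟶ I), ∃ k : U ⟶ R, k ≫ le = lift x (toUnit U ≫ one)

attribute [instance] LinearInterval.mono_le

namespace LinearInterval

variable {C} (𝕀 : LinearInterval C)

/-- The endpoint map `2 = 1 + 1 ⟶ 𝕀`. -/
def endpoints : 𝟙_ C ⨿ 𝟙_ C ⟶ 𝕀.I := coprod.desc 𝕀.zero 𝕀.one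

/-- The interval is non-trivial: the endpoint map `2 ⟶ 𝕀` is not a regular epimorphism. -/
def NonTrivial : Prop := ¬ IsRegularEpi 𝕀.endpoints

/-- The two endpoint inclusions `δ 0, δ 1 : 1 ⟶ 𝕀`. -/
def δ : Fin 2 → Arrow C := ![Arrow.mk 𝕀.zero, Arrow.mk 𝕀.one]

/-- The subobject `T₀ = {(x, y) | x ≥ y}` of `𝕀 × 𝕀`. -/
def T₀ : 𝕀.R ⟶ 𝕀.I ⊗ 𝕀.I := 𝕀.le ≫ lift (snd 𝕀.I 𝕀.I) (fst 𝕀.I 𝕀.I)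

/-- The subobject `T₁ = {(x, y) | x ≤ y}` of `𝕀 × 𝕀`. -/
def T₁ : 𝕀.R ⟶ 𝕀.I ⊗ 𝕀.I := 𝕀.le

instance : Mono 𝕀.T₁ := 𝕀.mono_le

instance : Mono 𝕀.T₀ := by
  have : IsIso (lift (snd 𝕀.I 𝕀.I) (fst 𝕀.I 𝕀.I)) :=
    ⟨lift (snd 𝕀.I 𝕀.I) (fst 𝕀.I 𝕀.I), by ext <;> simp, by ext <;> simp⟩
  exact mono_comp _ _

section Z

variable [HasFiniteLimits C] [HasSubobjectClassifier C]

open HasSubobjectClassifier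

instance : Mono (lift (truth C) (truth C)) :=
  mono_of_mono_fac (lift_fst (truth C) (truth C))

variable (C) in
/-- Internal conjunction `∧ : Ω × Ω ⟶ Ω`, the classifier of `(⊤, ⊤)`. -/
def conj : Ω C ⊗ Ω C ⟶ Ω C := χ (lift (truth C) (truth C))

/-- The family `Z ⟶ 𝕀 × 𝕀` with fibres `Z (x, y) = {φ ∈ Ω | x ≥ y → φ}`. The condition
`x ≥ y → φ` is expressed as the equation `(x ≥ y) ∧ φ = (x ≥ y)` in `Ω`. -/
def Z : Arrow C :=
  Arrow.mk (equalizer.ι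
    (lift (fst (𝕀.I ⊗ 𝕀.I) (Ω C) ≫ χ 𝕀.T₀) (snd (𝕀.I ⊗ 𝕀.I) (Ω C)) ≫ conj C)
    (fst (𝕀.I ⊗ 𝕀.I) (Ω C) ≫ χ 𝕀.T₀) ≫ fst (𝕀.I ⊗ 𝕀.I) (Ω C))

/-- Kan fibration structures on `f`, for the interval `𝕀`: fibred lifting structures, over the
codomain fibration, against the pushout products of the endpoint inclusions with the generic
monomorphism `1 ⟶ Ω`. -/
abbrev KanStructure [HasPushouts C] (f : Arrow C) :=
  LiftingStructure (kanMaps 𝕀.δ (genericMono C)) f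

end Z

end LinearInterval

end Interval

/-! ### Simplicial sets -/

section Simplicial

open Simplicial

/-- The endpoint inclusions `Δ[0] ⟶ Δ[1]`. -/
def endpoint (i : Fin 2) : Arrow SSet.{w} :=
  Arrow.mk (SSet.stdSimplex.δ i : (Δ[0] : SSet.{w}) ⟶ Δ[1])

/-- The object `Ω_dec` of locally (i.e. levelwise) decidable truth values: an `n`-simplex `ω` of
`Ω` belongs to it if the subobject of `Δ[n]` which it classifies is levelwise complemented. -/
def decidableΩ : (HasSubobjectClassifier.Ω SSet.{w}).Subcomplex where
  obj n := {ω | ∀ k : SimplexCategoryᵒᵖ, IsComplemented (Set.ofPred fun α : n ⟶ k =>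
    (HasSubobjectClassifier.Ω SSet.{w}).map α ω ∈
      Set.range ((HasSubobjectClassifier.truth SSet.{w}).app k))}
  map {n n'} β ω hω k := by
    obtain ⟨s, hs⟩ := hω k
    refine ⟨{α | β ≫ α ∈ s}, compl_eq_iff_isCompl.1 ?_⟩
    ext α
    have := Set.ext_iff.1 (compl_eq_iff_isCompl.2 hs) (β ≫ α)
    simpa using this

/-- The generic locally decidable monomorphism, with all its reindexings: the restriction of the
generic monomorphism to `Ω_dec`. -/
def genericDecidableMono :
    Over (decidableΩ.{w} : SSet.{w}) ⥤ Arrow SSet.{w} :=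
  Over.map decidableΩ.{w}.ι ⋙ genericMono SSet.{w}

/-- The set of all subobjects of representables. -/
def subobjectsOfRepresentables (a : Σ n : ℕ, (Δ[n] : SSet.{w}).Subcomplex) : Arrow SSet.{w} :=
  Arrow.mk a.2.ι

/-- The boundary inclusions `∂Δ[n] ⟶ Δ[n]`, `n ≥ 0`. -/
def boundaryInclusion (n : ℕ) : Arrow SSet.{w} :=
  Arrow.mk (SSet.boundary.{w} n).ι

/-- The horn inclusions `Λ[n, k] ⟶ Δ[n]`, `n ≥ 1`, `0 ≤ k ≤ n`. -/
def hornInclusion (a : Σ n : ℕ, Fin (n + 2)) : Arrow SSet.{w} :=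
  Arrow.mk (SSet.horn.{w} (a.1 + 1) a.2).ι

end Simplicial

end Definability

end

open Definability

namespace Definability

open HasSubobjectClassifier Opposite

/-! ### Predicates on generalised elements -/

section Logic

variable {C : Type u} [Category.{v} C]

/-! Definability makes lifting structures local on the base. For a structure `s` on `f`, the
transpose of `𝟙 f` under the adjunction is a cartesian square from `(f, s)` to the cofree structured
map, and on underlying squares it is a section of the counit. If `s` and `t` restrict equally along
a jointly epimorphic family, the codomain components of their transposes agree on that family, hence
agree. The counit is a pullback square, so the domain components agree too, and both structures are
read off the cofree one through the same square (`eq_of_reindex_eq`). It therefore suffices to find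
two different structures on the family `Z` that agree over `T₀` and over `T₁`, since these cover the
square of the interval.

Lifting a generating map `A ⟶ B` against `Z`, with base map `p`, means extending a truth value from
`A` to `B`, subject to being true over `T₀`. A filler is given by "true at every element of `A` over
`b`, and `b` lies in `ρ`", where `ρ` is a region of `B`, natural in the generating map, that
contains `A` and the preimage of `T₀` (`Region.liftingStructure`). One structure comes from the
region that is everything. The other region must become everything when `p` lands in `T₁`, but not
in general. Adding the preimage of `T₁` would be too much, because `T₀` and `T₁` cover; instead one
adds the points whose whole fibre, in the direction of filling, lies in `T₁`.

For a pushout product of an endpoint `E` with `A ⟶ B`, the fibre of `(t, x)` consists of all `(t',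
x)`. Take `e : B ⟶ 𝕀` such that `A` contains the preimages of `0` and `1`, put `p (t, x) = (e x, t)`
and `E = {0}`, and look at `t = 1`. Each clause of the region then forces `e x` to be `0` or `1`, so
equality of the two structures gives `A = B`. In a topos, where `A` may be any subobject of `𝕀`
containing both endpoints, this makes the endpoint map a regular epimorphism by definite description
(`exists_graph`). In simplicial sets, the boundary of `Δ[1]` belongs to all four families of
monomorphisms and is proper.

For horns, the single inclusion `{0} ⟶ Δ[1]`, multiplied by `U = Δ[1]`, suffices. Fibres are those
of the projection to `U`, and the section `u ↦ (u, 1)` lies outside the region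
(`FibreProjection.not_definable`). -/

/-- The generalised element `b` belongs to the subobject `m`. -/
def Hits {U X V : C} (m : U ⟶ X) (b : V ⟶ X) : Prop := ∃ k : V ⟶ U, k ≫ m = b

lemma Hits.precomp {U X V W : C} {m : U ⟶ X} {b : V ⟶ X} (h : Hits m b) (w : W ⟶ V) :
    Hits m (w ≫ b) := by
  obtain ⟨k, rfl⟩ := h
  exact ⟨w ≫ k, by simp⟩

variable [HasSubobjectClassifier C]

/-- The truth value `φ` is true. -/
def Holds {V : C} (φ : V ⟶ Ω C) : Prop := Hits (truth C) φ

lemma Holds.precomp {V W : C} {φ : V ⟶ Ω C} (h : Holds φ) (w : W ⟶ V) : Holds (w ≫ φ) :=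
  Hits.precomp h w

lemma holds_χ_iff {U X V : C} (m : U ⟶ X) [Mono m] (b : V ⟶ X) :
    Holds (b ≫ χ m) ↔ Hits m b := by
  constructor
  · rintro ⟨a, ha⟩
    exact ⟨(isPullback_χ m).lift b a ha.symm, by simp⟩
  · rintro ⟨k, rfl⟩
    exact ⟨k ≫ Subobject.Classifier.χ₀ _ U, by simp [HasSubobjectClassifier.comm]⟩

/-- A predicate on the generalised elements of `B` is classified if it is given by a morphism
`B ⟶ Ω`. -/
def IsClassified {B : C} (Q : ∀ ⦃V : C⦄, (V ⟶ B) → Prop) : Prop :=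
  ∃ φ : B ⟶ Ω C, ∀ ⦃V : C⦄ (b : V ⟶ B), Holds (b ≫ φ) ↔ Q b

section

variable {B : C} {Q R : ∀ ⦃V : C⦄, (V ⟶ B) → Prop}

lemma IsClassified.congr (hQ : IsClassified Q) (h : ∀ ⦃V : C⦄ (b : V ⟶ B), Q b ↔ R b) :
    IsClassified R := by
  obtain ⟨φ, hφ⟩ := hQ
  exact ⟨φ, fun V b => (hφ b).trans (h b)⟩

lemma isClassified_hits {U : C} (m : U ⟶ B) [Mono m] : IsClassified fun _ b => Hits m b :=
  ⟨χ m, fun _ b => holds_χ_iff m b⟩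

lemma IsClassified.comp (hQ : IsClassified Q) {B' : C} (f : B' ⟶ B) :
    IsClassified fun _ b => Q (b ≫ f) := by
  obtain ⟨φ, hφ⟩ := hQ
  exact ⟨f ≫ φ, fun V b => by rw [← Category.assoc]; exact hφ _⟩

variable [HasFiniteLimits C]

/-- A truth value is the classifier of the subobject on which it holds. This extensionality
principle turns equations between fillers into logical equivalences. -/
lemma eq_of_holds_iff {V : C} {φ ψ : V ⟶ Ω C}
    (h : ∀ ⦃W : C⦄ (w : W ⟶ V), Holds (w ≫ φ) ↔ Holds (w ≫ ψ)) : φ = ψ := by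
  have key : ∀ ξ : V ⟶ Ω C, (∀ ⦃W : C⦄ (w : W ⟶ V), Holds (w ≫ φ) ↔ Holds (w ≫ ξ)) →
      ξ = χ (pullback.fst φ (truth C)) := by
    intro ξ hξ
    obtain ⟨a, ha⟩ : Holds (pullback.fst φ (truth C) ≫ ξ) :=
      (hξ _).1 ⟨pullback.snd _ _, pullback.condition.symm⟩
    obtain rfl : a = Subobject.Classifier.χ₀ _ _ := Subsingleton.elim _ _
    have hits : ∀ ⦃W : C⦄ (x : W ⟶ V), Holds (x ≫ ξ) → Hits (pullback.fst φ (truth C)) x := by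
      intro W x hx
      obtain ⟨c, hc⟩ := (hξ x).2 hx
      exact ⟨pullback.lift x c hc.symm, pullback.lift_fst _ _ _⟩
    refine HasSubobjectClassifier.unique _ _ ⟨⟨ha.symm⟩, ⟨PullbackCone.IsLimit.mk _
      (fun s => (hits s.fst ⟨s.snd, s.condition.symm⟩).choose)
      (fun s => (hits s.fst ⟨s.snd, s.condition.symm⟩).choose_spec)
      (fun s => Subsingleton.elim _ _) (fun s l h₁ _ => ?_)⟩⟩
    rw [← cancel_mono (pullback.fst φ (truth C)), h₁]
    exact (hits s.fst ⟨s.snd, s.condition.symm⟩).choose_spec.symm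
  rw [key φ fun _ _ => Iff.rfl, key ψ h]

/-- Classified by the characteristic map of the equalizer. Implication and both forms of universal
quantification are reduced to this case by writing them as equations. -/
lemma isClassified_eq {X : C} (f g : B ⟶ X) : IsClassified fun _ b => b ≫ f = b ≫ g := by
  refine (isClassified_hits (equalizer.ι f g)).congr fun V b => ⟨?_, fun h => ?_⟩
  · rintro ⟨k, rfl⟩
    rw [Category.assoc, equalizer.condition, Category.assoc]
  · exact ⟨equalizer.lift b h, by simp⟩

lemma isClassified_true : IsClassified fun ⦃V : C⦄ (_ : V ⟶ B) => True :=
  (isClassified_eq (𝟙 B) (𝟙 B)).congr fun _ _ => by simp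

/-- The condition says that, after pulling back along `b`, the subobject `i` equals its part where
`ζ` holds, which is an equation between two characteristic maps. -/
lemma isClassified_forall_of_mono {L : C} (i : L ⟶ B) [Mono i] (ζ : L ⟶ Ω C) :
    IsClassified fun V b => ∀ ⦃W : C⦄ (w : W ⟶ V) (a : W ⟶ L), a ≫ i = w ≫ b →
      Holds (a ≫ ζ) := by
  refine (isClassified_eq (χ i) (χ (pullback.fst ζ (truth C) ≫ i))).congr fun V b => ?_
  have hsub : ∀ ⦃W : C⦄ (x : W ⟶ B), Hits (pullback.fst ζ (truth C) ≫ i) x ↔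
      ∃ a : W ⟶ L, a ≫ i = x ∧ Holds (a ≫ ζ) := by
    intro W x
    constructor
    · rintro ⟨k, rfl⟩
      exact ⟨k ≫ pullback.fst _ _, Category.assoc _ _ _, k ≫ pullback.snd _ _, by
        rw [Category.assoc, Category.assoc, pullback.condition]⟩
    · rintro ⟨a, rfl, c, hc⟩
      exact ⟨pullback.lift a c hc.symm, pullback.lift_fst_assoc _ _ _ _⟩
  constructor
  · intro h W w a ha
    have h₁ : Holds ((w ≫ b) ≫ χ i) := (holds_χ_iff _ _).2 ⟨a, ha⟩
    rw [Category.assoc, h, ← Category.assoc, holds_χ_iff, hsub] at h₁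
    obtain ⟨a', ha', h'⟩ := h₁
    rwa [← (cancel_mono i).1 (ha'.trans ha.symm)]
  · intro h
    refine eq_of_holds_iff fun W w => ?_
    rw [← Category.assoc, ← Category.assoc, holds_χ_iff, holds_χ_iff, hsub]
    constructor
    · rintro ⟨a, ha⟩
      exact ⟨a, ha, h w a ha⟩
    · rintro ⟨a, ha, -⟩
      exact ⟨a, ha⟩

end

end Logic

/-! ### Internal conjunction, implication and universal quantification. -/

section Cartesian

variable {C : Type u} [Category.{v} C] [CartesianMonoidalCategory C]
  [HasSubobjectClassifier C] {B : C} {Q R : ∀ ⦃V : C⦄, (V ⟶ B) → Prop}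

lemma holds_conj_iff {V : C} (φ ψ : V ⟶ Ω C) :
    Holds (lift φ ψ ≫ LinearInterval.conj C) ↔ Holds φ ∧ Holds ψ := by
  rw [LinearInterval.conj, holds_χ_iff]
  constructor
  · rintro ⟨k, hk⟩
    exact ⟨⟨k, by simpa using congrArg (fun t => t ≫ fst _ _) hk⟩,
      ⟨k, by simpa using congrArg (fun t => t ≫ snd _ _) hk⟩⟩
  · rintro ⟨⟨k, rfl⟩, ⟨l, rfl⟩⟩
    obtain rfl : k = l := Subsingleton.elim _ _
    exact ⟨k, by simp⟩

lemma IsClassified.and (hQ : IsClassified Q) (hR : IsClassified R) :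
    IsClassified fun _ b => Q b ∧ R b := by
  obtain ⟨φ, hφ⟩ := hQ
  obtain ⟨ψ, hψ⟩ := hR
  refine ⟨lift φ ψ ≫ LinearInterval.conj C, fun V b => ?_⟩
  rw [← Category.assoc, comp_lift, holds_conj_iff]
  exact and_congr (hφ b) (hψ b)

variable [HasFiniteLimits C]

/-- Implication is the equation `Q ∧ R = Q` in `Ω`; extensionality unfolds it into a statement about
all later stages `W`. -/
lemma IsClassified.imp (hQ : IsClassified Q) (hR : IsClassified R) :
    IsClassified fun V b => ∀ ⦃W : C⦄ (w : W ⟶ V), Q (w ≫ b) → R (w ≫ b) := by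
  obtain ⟨φ, hφ⟩ := hQ
  obtain ⟨ψ, hψ⟩ := hR
  refine (isClassified_eq (lift φ ψ ≫ LinearInterval.conj C) φ).congr fun V b => ?_
  have h : ∀ ⦃W : C⦄ (w : W ⟶ V), Holds (w ≫ b ≫ lift φ ψ ≫ LinearInterval.conj C) ↔
      Q (w ≫ b) ∧ R (w ≫ b) := fun W w => by
    rw [← hφ, ← hψ, ← holds_conj_iff]
    simp only [Category.assoc, comp_lift_assoc]
  constructor
  · intro e W w hw
    refine ((h w).1 ?_).2
    rw [e, ← Category.assoc, hφ]
    exact hw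
  · intro hb
    refine eq_of_holds_iff fun W w => ?_
    rw [h, ← Category.assoc, hφ]
    exact ⟨And.left, fun hw => ⟨hw, hb w hw⟩⟩

/-- A predicate holds for all `t` exactly when its transpose equals that of the constantly true
predicate. -/
lemma IsClassified.forall [MonoidalClosed C] {I : C} {Q : ∀ ⦃V : C⦄, (V ⟶ I ⊗ B) → Prop}
    (hQ : IsClassified Q) :
    IsClassified fun V b => ∀ ⦃W : C⦄ (w : W ⟶ V) (t : W ⟶ I), Q (lift t (w ≫ b)) := by
  obtain ⟨φ, hφ⟩ := hQ
  obtain ⟨τ, hτ⟩ := isClassified_true (B := I ⊗ B)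
  refine (isClassified_eq (MonoidalClosed.curry φ) (MonoidalClosed.curry τ)).congr fun V b => ?_
  rw [← MonoidalClosed.curry_natural_left, ← MonoidalClosed.curry_natural_left,
    MonoidalClosed.curry_injective.eq_iff]
  constructor
  · intro e W w t
    have := congrArg (fun x => lift t w ≫ x) e
    simp only [← Category.assoc, lift_whiskerLeft] at this
    rw [← hφ, this, hτ]
    trivial
  · intro h
    refine eq_of_holds_iff fun W w => ?_
    have hw : w ≫ I ◁ b = lift (w ≫ fst _ _) ((w ≫ snd _ _) ≫ b) := by
      ext <;> simp
    rw [← Category.assoc, ← Category.assoc, hw, hφ, hτ]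
    exact iff_of_true (h _ _) trivial

end Cartesian

/-! ### Definable lifting structures glue uniquely -/

section Gluing

variable {C : Type u} [Category.{v} C] [HasPullbacks C] {J : Type u₁} [Category.{v₁} J]
  {m : J ⥤ Arrow C}

/-- The pullback of a structured map along `τ`, as a morphism of `Cart`. -/
noncomputable def reindexHom {f : Arrow C} (t : LiftingStructure m f) {Y : C} (τ : Y ⟶ f.right) :
    (⟨⟨_, t.reindex τ⟩⟩ : Cart (RightMap.forget m ⋙ Arrow.rightFunc)) ⟶ ⟨⟨f, t⟩⟩ :=
  let sq : Arrow.mk (pullback.snd f.hom τ) ⟶ f :=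
    Arrow.homMk (pullback.fst f.hom τ) τ pullback.condition
  have hsq : IsPullback sq.left (pullback.snd f.hom τ) f.hom sq.right :=
    IsPullback.of_hasPullback f.hom τ
  ⟨RightMap.lift m (Y := ⟨f, t⟩) sq hsq, RightMap.cartesian_of_isPullback m _ hsq⟩

/-- If a lifting notion is definable, two lifting structures on `f` agree as soon as their
restrictions along a jointly epimorphic family of morphisms agree. -/
lemma eq_of_reindex_eq (h : (liftingNotion m).Definable) {f : Arrow C}
    {s t : LiftingStructure m f} {ι : Type*} {Y : ι → C} (τ : ∀ i, Y i ⟶ f.right)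
    (hτ : ∀ ⦃X : C⦄ (a b : f.right ⟶ X), (∀ i, τ i ≫ a = τ i ≫ b) → a = b)
    (hst : ∀ i, s.reindex (τ i) = t.reindex (τ i)) : s = t := by
  let F := cartMap (RightMap.forget m ⋙ Arrow.rightFunc) Arrow.rightFunc (RightMap.forget m)
    (liftingNotion m).preserves
  have hF : F.IsLeftAdjoint := h
  let adj := Adjunction.ofIsLeftAdjoint F
  let f' : Cart (Arrow.rightFunc : Arrow C ⥤ C) := ⟨f⟩
  let tr (r : LiftingStructure m f) : (⟨⟨f, r⟩⟩ : Cart (RightMap.forget m ⋙ Arrow.rightFunc)) ⟶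
      F.rightAdjoint.obj f' :=
    adj.homEquiv _ _ (𝟙 f')
  let ε := adj.counit.app f'
  have hε : IsPullback ε.hom.left _ _ ε.hom.right := (cartesian_rightFunc_iff _).1 ε.property
  -- By adjunction, `tr r` is a section of the counit.
  have htr (r : LiftingStructure m f) : F.map (tr r) ≫ ε = 𝟙 f' := by
    refine (adj.homEquiv_counit (g := tr r)).symm.trans ?_
    exact Equiv.symm_apply_apply _ _
  have hsq (r : LiftingStructure m f) : (tr r).hom.sq ≫ ε.hom = 𝟙 f :=
    congrArg InducedWideCategory.Hom.hom (htr r)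
  have hcomp (r : LiftingStructure m f) (i : ι) :
      reindexHom r (τ i) ≫ tr r =
        adj.homEquiv _ f' (F.map (reindexHom r (τ i))) := by
    refine (Adjunction.homEquiv_naturality_left adj _ _).symm.trans ?_
    exact congrArg _ (Category.comp_id _)
  -- Precomposed with the restriction along `τ i`, the square `tr r` becomes the transpose of a
  -- pullback square that depends on `r` only through its restriction.
  have hright : (tr s).hom.sq.right = (tr t).hom.sq.right := by
    refine hτ _ _ fun i => ?_
    -- The two restricted objects are only propositionally equal, so the structures are generalised
    -- before they are identified.
    have key : ∀ (a b : LiftingStructure m (Arrow.mk (pullback.snd f.hom (τ i)))) (hab : a = b)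
      (φ : F.obj ⟨⟨_, a⟩⟩ ⟶ f') (ψ : F.obj ⟨⟨_, b⟩⟩ ⟶ f') (_ : φ.hom = ψ.hom),
      (adj.homEquiv _ _ φ).hom.sq = (adj.homEquiv _ _ ψ).hom.sq := by
      rintro a _ rfl φ ψ h
      obtain rfl : φ = ψ := by
        ext1
        exact h
      rfl
    have := key _ _ (hst i) (F.map (reindexHom s (τ i))) (F.map (reindexHom t (τ i))) rfl
    rw [← hcomp, ← hcomp] at this
    exact congrArg CommaMorphism.right this
  have hsqeq : (tr s).hom.sq = (tr t).hom.sq := by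
    ext
    · refine hε.hom_ext ?_ ?_
      · exact congrArg CommaMorphism.left ((hsq s).trans (hsq t).symm)
      · have h₁ := Arrow.w (tr s).hom.sq
        have h₂ := Arrow.w (tr t).hom.sq
        rw [hright] at h₁
        exact h₁.trans h₂.symm
    · exact hright
  -- Fillers for `s` and `t` can now be compared inside the cofree structured map, where both become
  -- the filler of one and the same composite square.
  have hmono : Mono (tr s).hom.sq.left := by
    have : (tr s).hom.sq.left ≫ ε.hom.left = 𝟙 _ := congrArg CommaMorphism.left (hsq s)
    have : Mono ((tr s).hom.sq.left ≫ ε.hom.left) := by rw [this]; infer_instance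
    exact mono_of_mono _ ε.hom.left
  ext j sq
  rw [← cancel_mono (tr s).hom.sq.left]
  have h₁ := (tr s).hom.comm j sq
  have h₂ := (tr t).hom.comm j sq
  rw [← hsqeq] at h₂
  exact h₁.trans h₂.symm

end Gluing

/-! ### Families of truth values that hold on a subobject -/

section Family

variable {C : Type u} [Category.{v} C] [HasSubobjectClassifier C]

/-- The family `f` over `Y` has fibres `{φ ∈ Ω | y ∈ T → φ}`. -/
structure TruthFamily (f : Arrow C) {R : C} (T : R ⟶ f.right) where
  /-- the truth value underlying a point of the family -/
  value : f.left ⟶ Ω C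
  hom_ext : ∀ {V : C} {a b : V ⟶ f.left}, a ≫ f.hom = b ≫ f.hom → a ≫ value = b ≫ value → a = b
  exists_lift : ∀ {V : C} (y : V ⟶ f.right) (φ : V ⟶ Ω C),
    (∀ ⦃W : C⦄ (w : W ⟶ V), Hits T (w ≫ y) → Holds (w ≫ φ)) →
    ∃ a : V ⟶ f.left, a ≫ f.hom = y ∧ a ≫ value = φ
  holds_value : ∀ {V : C} (a : V ⟶ f.left), Hits T (a ≫ f.hom) → Holds (a ≫ value)

/-- The family `Z` of a linear interval is a family of truth values. -/
noncomputable def LinearInterval.truthFamily [CartesianMonoidalCategory C] [HasFiniteLimits C]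
    [HasFiniteCoproducts C] (𝕀 : LinearInterval C) :
    TruthFamily 𝕀.Z (R := 𝕀.R) (𝕀.T₀ : 𝕀.R ⟶ 𝕀.I ⊗ 𝕀.I) := by
  let Y := 𝕀.I ⊗ 𝕀.I
  let f₁ : Y ⊗ Ω C ⟶ Ω C := lift (fst Y (Ω C) ≫ χ 𝕀.T₀) (snd Y (Ω C)) ≫ conj C
  let f₂ : Y ⊗ Ω C ⟶ Ω C := fst Y (Ω C) ≫ χ 𝕀.T₀
  have iff : ∀ {V : C} (y : V ⟶ Y) (φ : V ⟶ Ω C), lift y φ ≫ f₁ = lift y φ ≫ f₂ ↔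
      (∀ ⦃W : C⦄ (w : W ⟶ V), Hits 𝕀.T₀ (w ≫ y) → Holds (w ≫ φ)) := by
    intro V y φ
    have h₁ : ∀ ⦃W : C⦄ (w : W ⟶ V), Holds (w ≫ lift y φ ≫ f₁) ↔
        Hits 𝕀.T₀ (w ≫ y) ∧ Holds (w ≫ φ) := by
      intro W w
      rw [← holds_χ_iff, ← holds_conj_iff]
      simp only [f₁, comp_lift_assoc, lift_fst_assoc, lift_snd, Category.assoc]
    have h₂ : ∀ ⦃W : C⦄ (w : W ⟶ V), Holds (w ≫ lift y φ ≫ f₂) ↔ Hits 𝕀.T₀ (w ≫ y) := by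
      intro W w
      rw [← holds_χ_iff]
      simp only [f₂, lift_fst_assoc, Category.assoc]
    constructor
    · intro e W w hw
      rw [← h₂, ← e, h₁] at hw
      exact hw.2
    · intro h
      refine eq_of_holds_iff fun W w => ?_
      rw [h₁, h₂]
      exact ⟨And.left, fun h' => ⟨h', h w h'⟩⟩
  have hom_ext : ∀ {V : C} {a b : V ⟶ equalizer f₁ f₂},
      a ≫ equalizer.ι f₁ f₂ ≫ fst Y (Ω C) = b ≫ equalizer.ι f₁ f₂ ≫ fst Y (Ω C) →
      a ≫ equalizer.ι f₁ f₂ ≫ snd Y (Ω C) = b ≫ equalizer.ι f₁ f₂ ≫ snd Y (Ω C) → a = b := by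
    intro V a b h₁ h₂
    refine equalizer.hom_ext (CartesianMonoidalCategory.hom_ext _ _ ?_ ?_)
    · rw [Category.assoc, Category.assoc, h₁]
    · rw [Category.assoc, Category.assoc, h₂]
  have exists_lift : ∀ {V : C} (y : V ⟶ Y) (φ : V ⟶ Ω C),
      (∀ ⦃W : C⦄ (w : W ⟶ V), Hits 𝕀.T₀ (w ≫ y) → Holds (w ≫ φ)) →
      ∃ a : V ⟶ equalizer f₁ f₂, a ≫ equalizer.ι f₁ f₂ ≫ fst Y (Ω C) = y ∧
        a ≫ equalizer.ι f₁ f₂ ≫ snd Y (Ω C) = φ := by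
    intro V y φ h
    exact ⟨equalizer.lift (lift y φ) ((iff y φ).2 h), by rw [equalizer.lift_ι_assoc, lift_fst],
      by rw [equalizer.lift_ι_assoc, lift_snd]⟩
  have holds_value : ∀ {V : C} (a : V ⟶ equalizer f₁ f₂),
      Hits 𝕀.T₀ (a ≫ equalizer.ι f₁ f₂ ≫ fst Y (Ω C)) →
      Holds (a ≫ equalizer.ι f₁ f₂ ≫ snd Y (Ω C)) := by
    intro V a h
    have e : lift (a ≫ equalizer.ι f₁ f₂ ≫ fst Y (Ω C)) (a ≫ equalizer.ι f₁ f₂ ≫ snd Y (Ω C)) =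
        a ≫ equalizer.ι f₁ f₂ := by
      ext <;> simp
    have := (iff _ _).1 (by rw [e, Category.assoc, equalizer.condition, Category.assoc]) (𝟙 _)
      (by rw [Category.id_comp]; exact h)
    rwa [Category.id_comp] at this
  exact ⟨equalizer.ι f₁ f₂ ≫ snd Y (Ω C), hom_ext, exists_lift, holds_value⟩

end Family

/-! ### Lifting structures on families of truth values -/

section Region

variable {C : Type u} [Category.{v} C] [CartesianMonoidalCategory C]
  [HasSubobjectClassifier C] {J : Type u₁} [Category.{v₁} J]

/-- A class of generalised elements of the domains of the generating maps `m j` which is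
jointly epimorphic, on which the maps `m j` are injective, and which is stable under
reindexing. -/
structure GeneratingElements (m : J ⥤ Arrow C) where
  /-- the distinguished generalised elements of the domain of `m j` -/
  mem : ∀ (j : J) ⦃W : C⦄, (W ⟶ (m.obj j).left) → Prop
  precomp : ∀ {j : J} {V W : C} {q : V ⟶ (m.obj j).left} (w : W ⟶ V), mem j q → mem j (w ≫ q)
  hom_ext : ∀ {j : J} {X : C} {f g : (m.obj j).left ⟶ X},
    (∀ ⦃W : C⦄ (q : W ⟶ (m.obj j).left), mem j q → q ≫ f = q ≫ g) → f = g
  inj : ∀ {j : J} {W : C} {q q' : W ⟶ (m.obj j).left}, mem j q → mem j q' →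
    q ≫ (m.obj j).hom = q' ≫ (m.obj j).hom → q = q'
  map : ∀ {j j' : J} (k : j ⟶ j') {W : C} {q : W ⟶ (m.obj j).left}, mem j q →
    mem j' (q ≫ (m.map k).left)
  cart : ∀ {j j' : J} (k : j ⟶ j') {W : C} (b : W ⟶ (m.obj j).right)
    (q : W ⟶ (m.obj j').left), mem j' q → q ≫ (m.obj j').hom = b ≫ (m.map k).right →
    ∃ q' : W ⟶ (m.obj j).left, mem j q' ∧ q' ≫ (m.obj j).hom = b
  classified : ∀ (j : J) (ζ : (m.obj j).left ⟶ Ω C),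
    IsClassified fun V (b : V ⟶ (m.obj j).right) => ∀ ⦃W : C⦄ (w : W ⟶ V)
      (q : W ⟶ (m.obj j).left), mem j q → q ≫ (m.obj j).hom = w ≫ b → Holds (q ≫ ζ)

/-- For a subobject `T` of `Y`, a choice, for each generating map `m j` and each morphism from
its codomain to `Y`, of a region of that codomain, containing the image of `m j` and the
preimage of `T`, naturally in `j`. -/
structure Region {m : J ⥤ Arrow C} (E : GeneratingElements m) {Y R : C} (T : R ⟶ Y) where
  /-- membership in the region -/
  mem : ∀ (j : J) (_ : (m.obj j).right ⟶ Y) ⦃V : C⦄, (V ⟶ (m.obj j).right) → Prop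
  classified : ∀ (j : J) (p : (m.obj j).right ⟶ Y), IsClassified (mem j p)
  natural : ∀ {j j' : J} (k : j ⟶ j') (p : (m.obj j').right ⟶ Y) {V : C}
    (b : V ⟶ (m.obj j).right), mem j ((m.map k).right ≫ p) b ↔ mem j' p (b ≫ (m.map k).right)
  of_mem : ∀ {j : J} (p : (m.obj j).right ⟶ Y) {V : C} {q : V ⟶ (m.obj j).left}, E.mem j q →
    mem j p (q ≫ (m.obj j).hom)
  of_hits : ∀ {j : J} (p : (m.obj j).right ⟶ Y) {V : C} {b : V ⟶ (m.obj j).right},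
    Hits T (b ≫ p) → mem j p b

/-- The region consisting of everything. -/
def Region.top [HasFiniteLimits C] {m : J ⥤ Arrow C} (E : GeneratingElements m) {Y R : C}
    (T : R ⟶ Y) : Region E T where
  mem _ _ _ _ := True
  classified _ _ := isClassified_true
  natural _ _ _ _ := Iff.rfl
  of_mem _ _ _ _ := trivial
  of_hits _ _ _ _ := trivial

namespace Region

variable {m : J ⥤ Arrow C} {E : GeneratingElements m} {f : Arrow C} {R : C} {T : R ⟶ f.right}
  (F : TruthFamily f T) (ρ : Region E T)

/-- The proposed truth value is admissible: over `T₀` the values prescribed on the domain of `m j`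
are already true, and the region contains the preimage of `T₀`. -/
lemma exists_fill (j : J) (sq : m.obj j ⟶ f) :
    ∃ a : (m.obj j).right ⟶ f.left, a ≫ f.hom = sq.right ∧
      ∀ ⦃V : C⦄ (b : V ⟶ (m.obj j).right), Holds (b ≫ a ≫ F.value) ↔
        (∀ ⦃W : C⦄ (w : W ⟶ V) (q : W ⟶ (m.obj j).left), E.mem j q →
          q ≫ (m.obj j).hom = w ≫ b → Holds (q ≫ sq.left ≫ F.value)) ∧
        ρ.mem j sq.right b := by
  obtain ⟨φ, hφ⟩ := (E.classified j (sq.left ≫ F.value)).and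
    (ρ.classified j sq.right)
  obtain ⟨a, ha, rfl⟩ := F.exists_lift sq.right φ (fun V b hb => by
    rw [hφ]
    refine ⟨fun W w q _ h => ?_, ρ.of_hits _ hb⟩
    rw [← Category.assoc]
    apply F.holds_value
    have : (q ≫ sq.left) ≫ f.hom = w ≫ b ≫ sq.right := by
      rw [Category.assoc, Arrow.w, reassoc_of% h]
    rw [this]
    exact hb.precomp w)
  exact ⟨a, ha, hφ⟩

/-- The filler whose truth value is the largest one within the region. -/
noncomputable def fill (j : J) (sq : m.obj j ⟶ f) :
    (m.obj j).right ⟶ f.left := (ρ.exists_fill F j sq).choose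

lemma fill_hom (j : J) (sq : m.obj j ⟶ f) :
    ρ.fill F j sq ≫ f.hom = sq.right := (ρ.exists_fill F j sq).choose_spec.1

lemma holds_fill_iff (j : J) (sq : m.obj j ⟶ f) {V : C}
    (b : V ⟶ (m.obj j).right) : Holds (b ≫ ρ.fill F j sq ≫ F.value) ↔
      (∀ ⦃W : C⦄ (w : W ⟶ V) (q : W ⟶ (m.obj j).left), E.mem j q →
        q ≫ (m.obj j).hom = w ≫ b → Holds (q ≫ sq.left ≫ F.value)) ∧
      ρ.mem j sq.right b := (ρ.exists_fill F j sq).choose_spec.2 b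

variable [HasFiniteLimits C]

/-- The lifting structure on the family of truth values that is determined by a region. -/
noncomputable def liftingStructure : LiftingStructure m f where
  fill j sq := ρ.fill F j sq
  fac_left j sq := by
    refine E.hom_ext fun W q hq => F.hom_ext ?_ (eq_of_holds_iff fun V w => ?_)
    · simp [ρ.fill_hom F]
    · have : w ≫ (q ≫ (m.obj j).hom ≫ ρ.fill F j sq) ≫ F.value =
          ((w ≫ q) ≫ (m.obj j).hom) ≫ ρ.fill F j sq ≫ F.value := by simp
      rw [this, ρ.holds_fill_iff F]
      constructor
      · intro h
        simpa using h.1 (𝟙 _) (w ≫ q) (E.precomp w hq) (by simp)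
      · intro h
        refine ⟨fun W' w' q' hq' e => ?_, ρ.of_mem _ (E.precomp w hq)⟩
        rw [← Category.assoc] at e
        -- The only distinguished element over the image of `q` is `q` itself, so the quantifier
        -- collapses to the prescribed value.
        rw [E.inj hq' (E.precomp w' (E.precomp w hq)) e]
        simpa using h.precomp w'
  fac_right j sq := ρ.fill_hom F j sq
  natural {j j'} k sq := by
    refine F.hom_ext ?_ (eq_of_holds_iff fun V b => ?_)
    · simp [ρ.fill_hom F]
    · have : b ≫ ((m.map k).right ≫ ρ.fill F j' sq) ≫ F.value =
          (b ≫ (m.map k).right) ≫ ρ.fill F j' sq ≫ F.value := by simp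
      rw [this, ρ.holds_fill_iff F, ρ.holds_fill_iff F, Arrow.comp_right, ρ.natural]
      refine and_congr_left fun _ => ⟨fun h W w q hq e => ?_, fun h W w q hq e => ?_⟩
      · obtain ⟨q', hq', e'⟩ := E.cart k (w ≫ b) q hq (by rw [e, Category.assoc])
        have : q' ≫ (m.map k).left = q := by
          refine E.inj (E.map k hq') hq ?_
          rw [Category.assoc, Arrow.w, reassoc_of% e', e]
        rw [← this]
        simpa using h w q' hq' e'
      · have := h w (q ≫ (m.map k).left) (E.map k hq) (by
          rw [Category.assoc, Arrow.w, reassoc_of% e])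
        simpa using this

lemma fill_eq_of_mem_iff {ρ ρ' : Region E T} {j : J} {sq : m.obj j ⟶ f}
    (h : ∀ ⦃V : C⦄ (b : V ⟶ (m.obj j).right), ρ.mem j sq.right b ↔ ρ'.mem j sq.right b) :
    ρ.fill F j sq = ρ'.fill F j sq := by
  refine F.hom_ext ?_ (eq_of_holds_iff fun V b => ?_)
  · rw [fill_hom, fill_hom]
  · rw [holds_fill_iff, holds_fill_iff, h]

/-- If the prescribed truth value on the domain is constantly true, the filler is the indicator of
the region; hence the structure determines its region. -/
lemma mem_iff_of_liftingStructure_eq {ρ ρ' : Region E T}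
    (h : ρ.liftingStructure F = ρ'.liftingStructure F) (j : J)
    (p : (m.obj j).right ⟶ f.right) {V : C} (b : V ⟶ (m.obj j).right) :
    ρ.mem j p b ↔ ρ'.mem j p b := by
  obtain ⟨τ, hτ⟩ := isClassified_true (B := (m.obj j).left)
  obtain ⟨a, ha, rfl⟩ := F.exists_lift ((m.obj j).hom ≫ p) τ
    fun W w _ => (hτ w).2 trivial
  let sq : m.obj j ⟶ f := Arrow.homMk a p ha
  have hsq : ∀ σ : Region E T, Holds (b ≫ σ.fill F j sq ≫ F.value) ↔ σ.mem j p b := by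
    intro σ
    rw [holds_fill_iff]
    exact and_iff_right fun W w q _ _ => (hτ q).2 trivial
  have h' : ρ.fill F j sq = ρ'.fill F j sq := congrArg (fun t => t.fill j sq) h
  rw [← hsq, ← hsq, h']

/-- A filler for the restricted structure is computed after composing the square with the pullback
square of `τ`, so only regions for base maps factoring through `τ` matter. -/
lemma reindex_eq_of_mem_iff {ρ ρ' : Region E T} {Y' : C} (τ : Y' ⟶ f.right)
    (h : ∀ (j : J) (p : (m.obj j).right ⟶ Y') ⦃V : C⦄ (b : V ⟶ (m.obj j).right),
      ρ.mem j (p ≫ τ) b ↔ ρ'.mem j (p ≫ τ) b) :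
    (ρ.liftingStructure F).reindex τ =
      (ρ'.liftingStructure F).reindex τ := by
  ext j sq
  refine (IsPullback.of_hasPullback f.hom τ).hom_ext ?_ ?_
  · exact (IsPullback.lift_fst _ _ _ _).trans
      ((fill_eq_of_mem_iff F fun V b => h j sq.right b).trans
      (IsPullback.lift_fst _ _ _ _).symm)
  · exact (IsPullback.lift_snd _ _ _ _).trans (IsPullback.lift_snd _ _ _ _).symm

end Region

end Region

/-! ### Pushout products of endpoint inclusions with monomorphisms -/

/-- The members of the diagram `m` are monomorphisms and its morphisms are cartesian squares. -/
structure IsCartesianMono {C : Type u} [Category.{v} C] {J : Type u₁} [Category.{v₁} J]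
    (m : J ⥤ Arrow C) : Prop where
  mono : ∀ j, Mono (m.obj j).hom
  hits : ∀ {j j' : J} (k : j ⟶ j') {W : C} (b : W ⟶ (m.obj j).right),
    Hits (m.obj j').hom (b ≫ (m.map k).right) → Hits (m.obj j).hom b

lemma IsCartesianMono.hits_iff {C : Type u} [Category.{v} C] {J : Type u₁} [Category.{v₁} J]
    {m : J ⥤ Arrow C} (hm : IsCartesianMono m) {j j' : J} (k : j ⟶ j') {W : C}
    (b : W ⟶ (m.obj j).right) :
    Hits (m.obj j').hom (b ≫ (m.map k).right) ↔ Hits (m.obj j).hom b := by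
  refine ⟨hm.hits k b, ?_⟩
  rintro ⟨a, rfl⟩
  exact ⟨a ≫ (m.map k).left, by simp⟩

section Kan

variable {C : Type u} [Category.{v} C] [CartesianMonoidalCategory C] [HasPushouts C]
  {J : Type u₁} [Category.{v₁} J]
  {δ : Fin 2 → Arrow C} {m : J ⥤ Arrow C}

namespace kanMaps

variable (δ m)

/-- The first leg of a pushout product. -/
noncomputable def inl (i : Fin 2) (j : J) :
    (δ i).right ⊗ (m.obj j).left ⟶ ((kanMaps δ m).obj (⟨i⟩, j)).left :=
  pushout.inl _ _

/-- The second leg of a pushout product. -/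
noncomputable def inr (i : Fin 2) (j : J) :
    (δ i).left ⊗ (m.obj j).right ⟶ ((kanMaps δ m).obj (⟨i⟩, j)).left :=
  pushout.inr _ _

/-- The first projection of the codomain of a pushout product. -/
noncomputable def p₁ (i : Fin 2) (j : J) :
    ((kanMaps δ m).obj (⟨i⟩, j)).right ⟶ (δ i).right := fst (δ i).right (m.obj j).right

/-- The second projection of the codomain of a pushout product. -/
noncomputable def p₂ (i : Fin 2) (j : J) :
    ((kanMaps δ m).obj (⟨i⟩, j)).right ⟶ (m.obj j).right := snd (δ i).right (m.obj j).right

variable {δ m} {i : Fin 2} {j j' : J}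

/-- The generalised element of the codomain of a pushout product with given coordinates. -/
noncomputable def pair {V : C} (t : V ⟶ (δ i).right) (x : V ⟶ (m.obj j).right) :
    V ⟶ ((kanMaps δ m).obj (⟨i⟩, j)).right := lift t x

@[simp]
lemma pair_p₁ {V : C} (t : V ⟶ (δ i).right) (x : V ⟶ (m.obj j).right) :
    pair t x ≫ p₁ δ m i j = t := lift_fst _ _

@[simp]
lemma pair_p₂ {V : C} (t : V ⟶ (δ i).right) (x : V ⟶ (m.obj j).right) :
    pair t x ≫ p₂ δ m i j = x := lift_snd _ _

lemma right_ext {V : C} {a b : V ⟶ ((kanMaps δ m).obj (⟨i⟩, j)).right}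
    (h₁ : a ≫ p₁ δ m i j = b ≫ p₁ δ m i j) (h₂ : a ≫ p₂ δ m i j = b ≫ p₂ δ m i j) : a = b :=
  CartesianMonoidalCategory.hom_ext (Y := (m.obj j).right) (X := (δ i).right) a b h₁ h₂

@[simp]
lemma comp_pair {V W : C} (w : W ⟶ V) (t : V ⟶ (δ i).right) (x : V ⟶ (m.obj j).right) :
    w ≫ pair t x = pair (w ≫ t) (w ≫ x) := right_ext (by simp) (by simp)

variable (δ m i j) in
/-- The identification of a product with the codomain of a pushout product. -/
noncomputable def ofProd : (δ i).right ⊗ (m.obj j).right ⟶ ((kanMaps δ m).obj (⟨i⟩, j)).right :=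
  pair (fst _ _) (snd _ _)

@[simp]
lemma lift_ofProd {V : C} (t : V ⟶ (δ i).right) (x : V ⟶ (m.obj j).right) :
    lift t x ≫ ofProd δ m i j = pair t x := by
  simp [ofProd]

lemma left_ext {X : C} {a b : ((kanMaps δ m).obj (⟨i⟩, j)).left ⟶ X}
    (h₁ : inl δ m i j ≫ a = inl δ m i j ≫ b) (h₂ : inr δ m i j ≫ a = inr δ m i j ≫ b) : a = b :=
  pushout.hom_ext h₁ h₂

lemma condition : (δ i).hom ▷ (m.obj j).left ≫ inl δ m i j =
    (δ i).left ◁ (m.obj j).hom ≫ inr δ m i j := pushout.condition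

lemma inl_hom : inl δ m i j ≫ ((kanMaps δ m).obj (⟨i⟩, j)).hom =
    pair (fst _ _) (snd _ _ ≫ (m.obj j).hom) :=
  (pushout.inl_desc _ _ _).trans
    (right_ext ((whiskerLeft_fst _ _).trans (pair_p₁ _ _).symm)
      ((whiskerLeft_snd _ _).trans (pair_p₂ _ _).symm))

lemma inr_hom : inr δ m i j ≫ ((kanMaps δ m).obj (⟨i⟩, j)).hom =
    pair (fst _ _ ≫ (δ i).hom) (snd _ _) :=
  (pushout.inr_desc _ _ _).trans
    (right_ext ((whiskerRight_fst _ _).trans (pair_p₁ _ _).symm)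
      ((whiskerRight_snd _ _).trans (pair_p₂ _ _).symm))

lemma mono_inl_hom [Mono (m.obj j).hom] :
    Mono (inl δ m i j ≫ ((kanMaps δ m).obj (⟨i⟩, j)).hom) := by
  refine ⟨fun a b e => ?_⟩
  rw [inl_hom] at e
  have h₁ := congrArg (fun t => t ≫ p₁ δ m i j) e
  have h₂ := congrArg (fun t => t ≫ p₂ δ m i j) e
  simp only [comp_pair, pair_p₁, pair_p₂] at h₁ h₂
  refine CartesianMonoidalCategory.hom_ext _ _ h₁ ((cancel_mono (m.obj j).hom).1 ?_)
  simpa using h₂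

lemma mono_inr_hom [Mono (δ i).hom] : Mono (inr δ m i j ≫ ((kanMaps δ m).obj (⟨i⟩, j)).hom) := by
  refine ⟨fun a b e => ?_⟩
  rw [inr_hom] at e
  have h₁ := congrArg (fun t => t ≫ p₁ δ m i j) e
  have h₂ := congrArg (fun t => t ≫ p₂ δ m i j) e
  simp only [comp_pair, pair_p₁, pair_p₂] at h₁ h₂
  refine CartesianMonoidalCategory.hom_ext _ _ ((cancel_mono (δ i).hom).1 ?_) h₂
  simpa using h₁

lemma map_right (k : ((⟨i⟩, j) : Discrete (Fin 2) × J) ⟶ (⟨i⟩, j')) :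
    ((kanMaps δ m).map k).right = pair (p₁ δ m i j) (p₂ δ m i j ≫ (m.map k.2).right) := by
  have : ((kanMaps δ m).map k).right = (δ i).right ◁ (m.map k.2).right := by
    simp [kanMaps]
    exact Category.id_comp _
  rw [this]
  exact right_ext ((whiskerLeft_fst _ _).trans (pair_p₁ _ _).symm)
    ((whiskerLeft_snd _ _).trans (pair_p₂ _ _).symm)

lemma inl_map (k : ((⟨i⟩, j) : Discrete (Fin 2) × J) ⟶ (⟨i⟩, j')) :
    inl δ m i j ≫ ((kanMaps δ m).map k).left =
      (δ i).right ◁ (m.map k.2).left ≫ inl δ m i j' := by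
  have : ((kanMaps δ m).map k).left = ((Functor.PushoutObjObj.ofHasPushout (curriedTensor C)
      (δ i).hom (m.obj j).hom).mapArrowRight
      (Functor.PushoutObjObj.ofHasPushout (curriedTensor C) (δ i).hom (m.obj j').hom)
        (m.map k.2)).left := by
    simp [kanMaps]
    exact Category.id_comp _
  rw [this]
  exact (Functor.PushoutObjObj.ofHasPushout (curriedTensor C)
      (δ i).hom (m.obj j).hom).isPushout.inl_desc _ _ _

lemma inr_map (k : ((⟨i⟩, j) : Discrete (Fin 2) × J) ⟶ (⟨i⟩, j')) :
    inr δ m i j ≫ ((kanMaps δ m).map k).left =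
      (δ i).left ◁ (m.map k.2).right ≫ inr δ m i j' := by
  have : ((kanMaps δ m).map k).left = ((Functor.PushoutObjObj.ofHasPushout (curriedTensor C)
      (δ i).hom (m.obj j).hom).mapArrowRight
      (Functor.PushoutObjObj.ofHasPushout (curriedTensor C) (δ i).hom (m.obj j').hom)
        (m.map k.2)).left := by
    simp [kanMaps]
    exact Category.id_comp _
  rw [this]
  exact (Functor.PushoutObjObj.ofHasPushout (curriedTensor C)
      (δ i).hom (m.obj j).hom).isPushout.inr_desc _ _ _

/-- The endpoint factor of the index category is discrete, so a morphism cannot change the endpoint.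
-/
lemma morphism_induction {P : ∀ ⦃a b : Discrete (Fin 2) × J⦄, (a ⟶ b) → Prop}
    (h : ∀ (i : Fin 2) (j j' : J) (k : ((⟨i⟩, j) : Discrete (Fin 2) × J) ⟶ (⟨i⟩, j')), P k)
    {a b : Discrete (Fin 2) × J} (k : a ⟶ b) : P k := by
  obtain ⟨⟨i⟩, j⟩ := a
  obtain ⟨⟨i'⟩, j'⟩ := b
  obtain rfl : i = i' := Discrete.eq_of_hom k.1
  exact h i j j' k

/-- The generalised elements of a pushout product which factor through one of the legs. -/
def mem (j : Discrete (Fin 2) × J) ⦃W : C⦄ (q : W ⟶ ((kanMaps δ m).obj j).left) : Prop :=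
  Hits (inl δ m j.1.as j.2) q ∨ Hits (inr δ m j.1.as j.2) q

variable [HasFiniteLimits C] [HasSubobjectClassifier C]

/-- The legs of the pushout products generate. -/
def generatingElements (hδ : ∀ i, Mono (δ i).hom) (hm : IsCartesianMono m) :
    GeneratingElements (kanMaps δ m) where
  -- Only elements that factor through a leg are used. The legs are jointly epimorphic and
  -- injectivity on such elements is elementary, so the pushout product itself need not be shown
  -- monic.
  mem := mem
  precomp w h := h.imp (·.precomp w) (·.precomp w)
  hom_ext := by
    intro j X f g h
    exact left_ext (h _ (Or.inl ⟨𝟙 _, by simp⟩)) (h _ (Or.inr ⟨𝟙 _, by simp⟩))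
  inj := by
    rintro ⟨⟨i⟩, j⟩ W q q' hq hq' e
    have := hδ i
    have := hm.mono j
    -- Elements of the two legs with the same image both come from the common corner, where the
    -- pushout condition identifies them.
    have key : ∀ (a : W ⟶ (δ i).right ⊗ (m.obj j).left) (b : W ⟶ (δ i).left ⊗ (m.obj j).right),
        (a ≫ inl δ m i j) ≫ ((kanMaps δ m).obj (⟨i⟩, j)).hom =
          (b ≫ inr δ m i j) ≫ ((kanMaps δ m).obj (⟨i⟩, j)).hom →
        a ≫ inl δ m i j = b ≫ inr δ m i j := by
      intro a b e
      rw [Category.assoc, Category.assoc, inl_hom, inr_hom] at e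
      have h₁ := congrArg (fun t => t ≫ p₁ δ m i j) e
      have h₂ := congrArg (fun t => t ≫ p₂ δ m i j) e
      simp only [comp_pair, pair_p₁, pair_p₂] at h₁ h₂
      have ha : a = lift (b ≫ fst _ _) (a ≫ snd _ _) ≫ (δ i).hom ▷ (m.obj j).left := by
        ext <;> simp [h₁]
      have hb : b = lift (b ≫ fst _ _) (a ≫ snd _ _) ≫ (δ i).left ◁ (m.obj j).hom := by
        ext <;> simp [h₂]
      rw [ha]
      conv_rhs => rw [hb]
      rw [Category.assoc, Category.assoc, condition]
    rcases hq with ⟨a, rfl⟩ | ⟨a, rfl⟩ <;> rcases hq' with ⟨b, rfl⟩ | ⟨b, rfl⟩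
    · have := mono_inl_hom (δ := δ) (m := m) (i := i) (j := j)
      simp only [Category.assoc] at e
      rw [(cancel_mono _).1 e]
    · exact key a b e
    · exact (key b a e.symm).symm
    · have := mono_inr_hom (δ := δ) (m := m) (i := i) (j := j)
      simp only [Category.assoc] at e
      rw [(cancel_mono _).1 e]
  map := by
    intro a b k
    induction k using morphism_induction with
    | h i j j' k =>
      rintro W q (⟨a, rfl⟩ | ⟨a, rfl⟩)
      · exact Or.inl ⟨a ≫ (δ i).right ◁ (m.map k.2).left, by simp [inl_map]⟩
      · exact Or.inr ⟨a ≫ (δ i).left ◁ (m.map k.2).right, by simp [inr_map]⟩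
  cart := by
    intro a b k
    induction k using morphism_induction with
    | h i j j' k =>
      rintro W b q (⟨a, rfl⟩ | ⟨a, rfl⟩) e
      · dsimp only at e a
        rw [Category.assoc, inl_hom, map_right] at e
        have h₁ := congrArg (fun t => t ≫ p₁ δ m i j') e
        have h₂ := congrArg (fun t => t ≫ p₂ δ m i j') e
        simp only [comp_pair, pair_p₁, pair_p₂] at h₁ h₂
        obtain ⟨c, hc⟩ := hm.hits k.2 (b ≫ p₂ δ m i j) ⟨a ≫ snd _ _, by simpa using h₂⟩
        refine ⟨lift (b ≫ p₁ δ m i j) c ≫ inl δ m i j, Or.inl ⟨_, rfl⟩, ?_⟩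
        rw [Category.assoc, inl_hom]
        exact right_ext (by simp) (by simp [hc])
      · dsimp only at e a
        rw [Category.assoc, inr_hom, map_right] at e
        have h₁ := congrArg (fun t => t ≫ p₁ δ m i j') e
        simp only [comp_pair, pair_p₁] at h₁
        refine ⟨lift (a ≫ fst _ _) (b ≫ p₂ δ m i j) ≫ inr δ m i j, Or.inr ⟨_, rfl⟩, ?_⟩
        rw [Category.assoc, inr_hom]
        exact right_ext (by simpa using h₁) (by simp)
  classified := by
    rintro ⟨⟨i⟩, j⟩ ζ
    have := hδ i
    have := hm.mono j
    have := mono_inl_hom (δ := δ) (m := m) (i := i) (j := j)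
    have := mono_inr_hom (δ := δ) (m := m) (i := i) (j := j)
    -- Quantifying over distinguished elements is the conjunction of two quantifications, each along
    -- a leg that is monic into the codomain.
    have h₁ := isClassified_forall_of_mono (inl δ m i j ≫ ((kanMaps δ m).obj (⟨i⟩, j)).hom)
      (inl δ m i j ≫ ζ)
    have h₂ := isClassified_forall_of_mono (inr δ m i j ≫ ((kanMaps δ m).obj (⟨i⟩, j)).hom)
      (inr δ m i j ≫ ζ)
    refine (h₁.and h₂).congr fun V b => ⟨?_, fun h => ⟨?_, ?_⟩⟩
    · rintro ⟨h₁, h₂⟩ W w q (⟨a, rfl⟩ | ⟨a, rfl⟩) e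
      · simpa using h₁ w a (by simpa using e)
      · simpa using h₂ w a (by simpa using e)
    · intro W w a e
      simpa using h w (a ≫ inl δ m i j) (Or.inl ⟨a, rfl⟩) (by simpa using e)
    · intro W w a e
      simpa using h w (a ≫ inr δ m i j) (Or.inr ⟨a, rfl⟩) (by simpa using e)

end kanMaps

end Kan

lemma LinearInterval.hits_T₀_iff {C : Type u} [Category.{v} C] [CartesianMonoidalCategory C]
    [HasFiniteCoproducts C] (𝕀 : LinearInterval C) {V : C} (x y : V ⟶ 𝕀.I) :
    Hits 𝕀.T₀ (lift x y) ↔ Hits 𝕀.le (lift y x) := by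
  constructor
  · rintro ⟨k, hk⟩
    refine ⟨k, ?_⟩
    have h₁ := congrArg (fun y => y ≫ fst 𝕀.I 𝕀.I) hk
    have h₂ := congrArg (fun y => y ≫ snd 𝕀.I 𝕀.I) hk
    simp only [LinearInterval.T₀, Category.assoc, lift_fst, lift_snd] at h₁ h₂
    ext <;> simp [h₁, h₂]
  · rintro ⟨k, hk⟩
    refine ⟨k, ?_⟩
    rw [LinearInterval.T₀, ← Category.assoc, hk]
    ext <;> simp

/-! ### Regions for pushout products, and how they are told apart. -/

section KanRegion

variable {C : Type u} [Category.{v} C] [CartesianMonoidalCategory C] [MonoidalClosed C]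
  [HasFiniteLimits C] [HasSubobjectClassifier C] [HasPushouts C] {J : Type u₁} [Category.{v₁} J]
  {δ : Fin 2 → Arrow C} {m : J ⥤ Arrow C}

namespace kanMaps

/-- Writing `A` for the subobject `m j`, the endpoint inclusion as `E` and a point of the codomain
of the pushout product as `(t, x)`, this is the region of those points for which `x ∈ A` holds as
soon as it is implied by each of `t ∈ E`, `p (t, x) ∈ T₀` and `∀ t', p (t', x) ∈ T₁`. -/
def regionMem {Y R₀ R₁ : C} (T₀ : R₀ ⟶ Y) (T₁ : R₁ ⟶ Y) (j : Discrete (Fin 2) × J)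
    (p : ((kanMaps δ m).obj j).right ⟶ Y) ⦃V : C⦄ (b : V ⟶ ((kanMaps δ m).obj j).right) : Prop :=
  -- This is a disjunction relative to `x ∈ A`, encoded by implications so that the connectives
  -- classified above suffice. The last clause quantifies over the whole fibre: with only `p (t, x)
  -- ∈ T₁`, the region would be everything whenever `T₀` and `T₁` cover.
  ∀ ⦃W : C⦄ (w : W ⟶ V),
    (∀ ⦃W' : C⦄ (w' : W' ⟶ W), Hits (δ j.1.as).hom ((w' ≫ w ≫ b) ≫ p₁ δ m j.1.as j.2) →
      Hits (m.obj j.2).hom ((w' ≫ w ≫ b) ≫ p₂ δ m j.1.as j.2)) ∧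
    (∀ ⦃W' : C⦄ (w' : W' ⟶ W), Hits T₀ ((w' ≫ w ≫ b) ≫ p) →
      Hits (m.obj j.2).hom ((w' ≫ w ≫ b) ≫ p₂ δ m j.1.as j.2)) ∧
    (∀ ⦃W' : C⦄ (w' : W' ⟶ W), (∀ ⦃W'' : C⦄ (w'' : W'' ⟶ W') (t : W'' ⟶ (δ j.1.as).right),
        Hits T₁ (pair t (w'' ≫ (w' ≫ w ≫ b) ≫ p₂ δ m j.1.as j.2) ≫ p)) →
      Hits (m.obj j.2).hom ((w' ≫ w ≫ b) ≫ p₂ δ m j.1.as j.2)) →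
    Hits (m.obj j.2).hom ((w ≫ b) ≫ p₂ δ m j.1.as j.2)

/-- The region `regionMem` of the codomains of the pushout products. -/
def region (hδ : ∀ i, Mono (δ i).hom) (hm : IsCartesianMono m) {Y R₀ R₁ : C} (T₀ : R₀ ⟶ Y)
    (T₁ : R₁ ⟶ Y) [Mono T₀] [Mono T₁] : Region (generatingElements hδ hm) T₀ where
  mem := regionMem T₀ T₁
  classified := by
    rintro ⟨⟨i⟩, j⟩ p
    have := hδ i
    have := hm.mono j
    have hA := (isClassified_hits (m.obj j).hom).comp (p₂ δ m i j)
    have hE := (isClassified_hits (δ i).hom).comp (p₁ δ m i j)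
    have h₀ := (isClassified_hits T₀).comp p
    have h₁ : IsClassified fun V (b : V ⟶ ((kanMaps δ m).obj (⟨i⟩, j)).right) =>
        ∀ ⦃W : C⦄ (w : W ⟶ V) (t : W ⟶ (δ i).right),
          Hits T₁ (pair t (w ≫ b ≫ p₂ δ m i j) ≫ p) := by
      refine ((((isClassified_hits T₁).comp (ofProd δ m i j ≫ p)).forall).comp
        (p₂ δ m i j)).congr fun V b => ?_
      simp only [← Category.assoc (lift _ _), lift_ofProd]
    exact ((hE.imp hA).and ((h₀.imp hA).and (h₁.imp hA))).imp hA
  natural := by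
    intro a b k
    induction k using morphism_induction with
    | h i j j' k =>
      intro p V b
      -- A morphism of generating maps keeps the interval coordinate and pulls `A` back to `A`, so
      -- every clause is preserved and reflected.
      have hk₁ : ∀ {W : C} (x : W ⟶ ((kanMaps δ m).obj (⟨i⟩, j)).right),
          (x ≫ ((kanMaps δ m).map k).right) ≫ p₁ δ m i j' = x ≫ p₁ δ m i j := by
        intro W x
        rw [map_right, Category.assoc, pair_p₁]
      have hk₂ : ∀ {W : C} (x : W ⟶ ((kanMaps δ m).obj (⟨i⟩, j)).right),
          (x ≫ ((kanMaps δ m).map k).right) ≫ p₂ δ m i j' =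
            (x ≫ p₂ δ m i j) ≫ (m.map k.2).right := by
        intro W x
        rw [map_right, Category.assoc, pair_p₂, Category.assoc]
      have hpair : ∀ {W : C} (t : W ⟶ (δ i).right) (x : W ⟶ (m.obj j).right),
          pair t x ≫ ((kanMaps δ m).map k).right ≫ p =
            pair t (x ≫ (m.map k.2).right) ≫ p := by
        intro W t x
        rw [map_right, ← Category.assoc]
        congr 1
        rw [comp_pair, pair_p₁, ← Category.assoc, pair_p₂]
      simp only [regionMem, hpair]
      simp only [← Category.assoc _ _ ((kanMaps δ m).map k).right]
      simp only [hk₁, hk₂, hm.hits_iff]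
      simp only [Category.assoc]
  of_mem := by
    rintro ⟨⟨i⟩, j⟩ p V q (⟨a, rfl⟩ | ⟨a, rfl⟩) W w h
    · refine ⟨w ≫ a ≫ snd _ _, ?_⟩
      simp [inl_hom]
    · have := h.1 (𝟙 _) ⟨w ≫ a ≫ fst _ _, by simp [inr_hom]⟩
      simpa using this
  of_hits := by
    intro j p V b hb W w h
    have := h.2.1 (𝟙 _) (by simpa using hb.precomp w)
    simpa using this

end kanMaps

/-- Two different lifting structures on `Z`, against pushout products of endpoint inclusions with
a diagram of monomorphisms, whose restrictions along `T₀` and `T₁` agree. -/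
lemma LinearInterval.exists_liftingStructure [HasFiniteCoproducts C] (𝕀 : LinearInterval C)
    {D : C} (d : Fin 2 → (D ⟶ 𝕀.I)) [∀ i, Mono (d i)] (i₀ : Fin 2)
    (hd : ∀ ⦃V : C⦄ (x : V ⟶ 𝕀.I), Hits (d i₀) x → x = toUnit V ≫ 𝕀.zero)
    (hm : IsCartesianMono m) :
    ∃ s t : LiftingStructure (kanMaps (fun i => Arrow.mk (d i)) m) 𝕀.Z,
      s.reindex 𝕀.T₀ = t.reindex 𝕀.T₀ ∧ s.reindex 𝕀.T₁ = t.reindex 𝕀.T₁ ∧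
      (s = t → ∀ (j : J) (e : (m.obj j).right ⟶ 𝕀.I),
        (∀ ⦃V : C⦄ (x : V ⟶ (m.obj j).right), x ≫ e = toUnit V ≫ 𝕀.zero →
          Hits (m.obj j).hom x) →
        (∀ ⦃V : C⦄ (x : V ⟶ (m.obj j).right), x ≫ e = toUnit V ≫ 𝕀.one →
          Hits (m.obj j).hom x) → Hits (m.obj j).hom (𝟙 _)) := by
  let δ : Fin 2 → Arrow C := fun i => Arrow.mk (d i)
  have hδ : ∀ i, Mono (δ i).hom := fun i => inferInstanceAs (Mono (d i))
  let ρ := kanMaps.region hδ hm 𝕀.T₀ 𝕀.T₁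
  let F := 𝕀.truthFamily
  refine ⟨(Region.top _ _).liftingStructure F, ρ.liftingStructure F,
    Region.reindex_eq_of_mem_iff F (R := 𝕀.R) 𝕀.T₀ ?_,
    Region.reindex_eq_of_mem_iff F (R := 𝕀.R) 𝕀.T₁ ?_, ?_⟩
  · intro j p V b
    exact iff_of_true trivial (ρ.of_hits _ ⟨b ≫ p, Category.assoc _ _ _⟩)
  · intro j p V b
    refine iff_of_true trivial fun W w h => ?_
    -- When the base map factors through `T₁`, the hypothesis of the fibrewise clause always holds.
    have := h.2.2 (𝟙 _) fun W'' w'' t => ⟨_, Category.assoc _ _ _⟩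
    simpa using this
  · intro h j e h₀ h₁
    -- The base map is `(t, x) ↦ (e x, t)`, tested at `t = 1`; the three clauses then each force `e
    -- x` to be an endpoint.
    let p : ((kanMaps δ m).obj (⟨i₀⟩, j)).right ⟶ 𝕀.I ⊗ 𝕀.I :=
      lift (kanMaps.p₂ δ m i₀ j ≫ e) (kanMaps.p₁ δ m i₀ j)
    let b : (m.obj j).right ⟶ ((kanMaps δ m).obj (⟨i₀⟩, j)).right :=
      kanMaps.pair (toUnit _ ≫ 𝕀.one : _ ⟶ 𝕀.I) (𝟙 _)
    have hb : kanMaps.regionMem 𝕀.T₀ 𝕀.T₁ (⟨i₀⟩, j) p b :=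
      (Region.mem_iff_of_liftingStructure_eq F h (⟨i₀⟩, j) p b).1 trivial
    have hbp₁ : b ≫ kanMaps.p₁ δ m i₀ j = toUnit _ ≫ 𝕀.one := kanMaps.pair_p₁ _ _
    have hbp₂ : b ≫ kanMaps.p₂ δ m i₀ j = 𝟙 _ := kanMaps.pair_p₂ _ _
    have hx₁ : ∀ ⦃W : C⦄ (x : W ⟶ (m.obj j).right),
        (x ≫ 𝟙 _ ≫ b) ≫ kanMaps.p₁ δ m i₀ j = toUnit W ≫ 𝕀.one := by
      intro W x
      rw [Category.id_comp, Category.assoc, hbp₁, ← Category.assoc]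
      congr 1
      exact toUnit_unique _ _
    have hx₂ : ∀ ⦃W : C⦄ (x : W ⟶ (m.obj j).right),
        (x ≫ 𝟙 _ ≫ b) ≫ kanMaps.p₂ δ m i₀ j = x := by
      intro W x
      rw [Category.id_comp, Category.assoc, hbp₂, Category.comp_id]
    have hxp : ∀ ⦃W : C⦄ (x : W ⟶ (m.obj j).right),
        (x ≫ 𝟙 _ ≫ b) ≫ p = lift (x ≫ e) (toUnit W ≫ 𝕀.one) := by
      intro W x
      simp only [p, comp_lift]
      rw [hx₁, ← Category.assoc, hx₂]
    have hpair : ∀ ⦃W : C⦄ (t : W ⟶ 𝕀.I) (x : W ⟶ (m.obj j).right),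
        (kanMaps.pair t x : W ⟶ ((kanMaps δ m).obj (⟨i₀⟩, j)).right) ≫ p = lift (x ≫ e) t := by
      intro W t x
      have h₁ : (kanMaps.pair t x : W ⟶ ((kanMaps δ m).obj (⟨i₀⟩, j)).right) ≫
        kanMaps.p₁ δ m i₀ j = t := kanMaps.pair_p₁ _ _
      have h₂ : (kanMaps.pair t x : W ⟶ ((kanMaps δ m).obj (⟨i₀⟩, j)).right) ≫
        kanMaps.p₂ δ m i₀ j = x := kanMaps.pair_p₂ _ _
      simp only [p, comp_lift]
      rw [← Category.assoc, h₁, h₂]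
    have key := hb (𝟙 _) ⟨fun W x hW => ?_, fun W x hW => ?_, fun W x hW => ?_⟩
    · rw [Category.id_comp, hbp₂] at key
      exact key
    -- Endpoint clause: `1` lies in `{0}`, hence `e x ≤ 1 = 0`.
    · rw [hx₁] at hW
      rw [hx₂]
      apply h₀
      refine 𝕀.le_antisymm _ _ ?_ (𝕀.zero_le _)
      rw [← hd _ hW]
      exact 𝕀.le_one _
    -- Clause for `T₀`: `e x ≥ 1`.
    · rw [hxp] at hW
      rw [hx₂]
      apply h₁
      refine 𝕀.le_antisymm _ _ (𝕀.le_one _) ?_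
      exact (𝕀.hits_T₀_iff _ _).1 hW
    · rw [hx₂]
      apply h₀
      refine 𝕀.le_antisymm _ _ ?_ (𝕀.zero_le _)
      -- Clause for `T₁`, evaluated at `t' = 0`: `e x ≤ 0`.
      have := hW (𝟙 _) (toUnit _ ≫ 𝕀.zero)
      rw [hx₂, Category.id_comp, hpair] at this
      exact this

end KanRegion

/-! ### Reindexings of a vertical map. -/

section Reindex

variable {C : Type u} [Category.{v} C] [HasPullbacks C] {I : C} {X Y : Over I} (g : X ⟶ Y)

namespace reindex

/-- The projection from the domain of `σ^* g` to that of `g`. -/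
noncomputable def leftFst (σ : Over I) : ((reindex g).obj σ).left ⟶ X.left :=
  pullback.fst X.hom σ.hom

/-- The projection from the codomain of `σ^* g` to that of `g`. -/
noncomputable def rightFst (σ : Over I) : ((reindex g).obj σ).right ⟶ Y.left :=
  pullback.fst Y.hom σ.hom

/-- The projection from the domain of `σ^* g` to that of `σ`. -/
noncomputable def leftSnd (σ : Over I) : ((reindex g).obj σ).left ⟶ σ.left :=
  pullback.snd X.hom σ.hom

/-- The projection from the codomain of `σ^* g` to that of `σ`. -/
noncomputable def rightSnd (σ : Over I) : ((reindex g).obj σ).right ⟶ σ.left :=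
  pullback.snd Y.hom σ.hom

variable {g} {σ σ' : Over I}

lemma hom_fst : ((reindex g).obj σ).hom ≫ rightFst g σ = leftFst g σ ≫ g.left :=
  pullback.lift_fst _ _ _

lemma hom_snd : ((reindex g).obj σ).hom ≫ rightSnd g σ = leftSnd g σ :=
  (pullback.lift_snd _ _ _).trans (Category.comp_id _)

lemma map_right_fst (τ : σ ⟶ σ') :
    ((reindex g).map τ).right ≫ rightFst g σ' = rightFst g σ :=
  (pullback.lift_fst _ _ _).trans (Category.comp_id _)

lemma map_right_snd (τ : σ ⟶ σ') :
    ((reindex g).map τ).right ≫ rightSnd g σ' = rightSnd g σ ≫ τ.left :=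
  pullback.lift_snd _ _ _

lemma right_condition : rightFst g σ ≫ Y.hom = rightSnd g σ ≫ σ.hom := pullback.condition

lemma left_ext {V : C} {a b : V ⟶ ((reindex g).obj σ).left}
    (h₁ : a ≫ leftFst g σ = b ≫ leftFst g σ) (h₂ : a ≫ leftSnd g σ = b ≫ leftSnd g σ) : a = b :=
  pullback.hom_ext h₁ h₂

lemma right_ext {V : C} {a b : V ⟶ ((reindex g).obj σ).right}
    (h₁ : a ≫ rightFst g σ = b ≫ rightFst g σ) (h₂ : a ≫ rightSnd g σ = b ≫ rightSnd g σ) :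
    a = b :=
  pullback.hom_ext h₁ h₂

lemma exists_left {V : C} (x : V ⟶ X.left) (u : V ⟶ σ.left) (h : x ≫ X.hom = u ≫ σ.hom) :
    ∃ a : V ⟶ ((reindex g).obj σ).left, a ≫ leftFst g σ = x ∧ a ≫ leftSnd g σ = u :=
  ⟨pullback.lift x u h, pullback.lift_fst _ _ _, pullback.lift_snd _ _ _⟩

lemma exists_right {V : C} (y : V ⟶ Y.left) (u : V ⟶ σ.left) (h : y ≫ Y.hom = u ≫ σ.hom) :
    ∃ a : V ⟶ ((reindex g).obj σ).right, a ≫ rightFst g σ = y ∧ a ≫ rightSnd g σ = u :=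
  ⟨pullback.lift y u h, pullback.lift_fst _ _ _, pullback.lift_snd _ _ _⟩

end reindex

open reindex

variable {g}

lemma hits_reindex_iff {σ : Over I} {V : C} (x : V ⟶ ((reindex g).obj σ).right) :
    Hits ((reindex g).obj σ).hom x ↔ Hits g.left (x ≫ rightFst g σ) := by
  constructor
  · rintro ⟨a, rfl⟩
    exact ⟨a ≫ leftFst g σ, by rw [Category.assoc, Category.assoc, hom_fst]⟩
  · rintro ⟨a, ha⟩
    obtain ⟨b, hb₁, hb₂⟩ := exists_left (g := g) (σ := σ) a (x ≫ rightSnd g σ) (by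
      rw [← Over.w g, ← Category.assoc, ha, Category.assoc, right_condition, Category.assoc])
    refine ⟨b, right_ext ?_ ?_⟩
    · rw [← ha, ← hb₁, Category.assoc, Category.assoc, hom_fst]
    · rw [← hb₂, Category.assoc, hom_snd]

lemma isCartesianMono_reindex (hg : Mono g.left) : IsCartesianMono (reindex g) where
  mono σ := by
    refine ⟨fun a b e => left_ext ((cancel_mono g.left).1 ?_) ?_⟩
    · rw [Category.assoc, Category.assoc, ← hom_fst, reassoc_of% e]
    · rw [← hom_snd, reassoc_of% e]
  hits τ W b h := by
    rw [hits_reindex_iff, Category.assoc, map_right_fst] at h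
    exact (hits_reindex_iff b).2 h

lemma isCartesianMono_genericMono [HasSubobjectClassifier C] : IsCartesianMono (genericMono C) :=
  isCartesianMono_reindex (inferInstanceAs (Mono (truth C)))

end Reindex

/-! ### The generic monomorphism. -/

section GenericMono

variable {C : Type u} [Category.{v} C] [HasPullbacks C] [HasSubobjectClassifier C]

variable (C) in
/-- The generic monomorphism, as a vertical map over `Ω`. -/
noncomputable abbrev genericMonoHom : Over.mk (truth C) ⟶ Over.mk (𝟙 (Ω C)) :=
  Over.homMk (truth C)

lemma hits_genericMono_iff {σ : Over (Ω C)} {V : C}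
    (x : V ⟶ ((reindex (genericMonoHom C)).obj σ).right) :
    Hits ((reindex (genericMonoHom C)).obj σ).hom x ↔
      Holds (x ≫ reindex.rightSnd (genericMonoHom C) σ ≫ σ.hom) := by
  have cond : reindex.rightFst (genericMonoHom C) σ =
      reindex.rightSnd (genericMonoHom C) σ ≫ σ.hom :=
    (Category.comp_id _).symm.trans reindex.right_condition
  rw [hits_reindex_iff]
  exact iff_of_eq (congrArg (fun t => Hits (truth C) (x ≫ t)) cond)

/-- Each subobject of `B` is a member of the family of all monomorphisms, up to isomorphism. -/
lemma exists_genericMono {B E : C} (i : E ⟶ B) [Mono i] :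
    ∃ (σ : Over (Ω C)) (e : ((genericMono C).obj σ).right ⟶ B)
      (u : B ⟶ ((genericMono C).obj σ).right),
      u ≫ e = 𝟙 B ∧ ∀ ⦃V : C⦄ (x : V ⟶ ((genericMono C).obj σ).right),
        Hits ((genericMono C).obj σ).hom x ↔ Hits i (x ≫ e) := by
  -- For `σ = χ i` the codomain is the pullback of an identity, hence a copy of `B`; only a section
  -- `u` of its projection to `B` is needed.
  obtain ⟨u, -, hu⟩ := reindex.exists_right (g := genericMonoHom C) (σ := Over.mk (χ i)) (χ i)
    (𝟙 B) (by simp)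
  refine ⟨Over.mk (χ i), reindex.rightSnd (genericMonoHom C) (Over.mk (χ i)), u, hu, fun V x => ?_⟩
  refine (hits_genericMono_iff x).trans ?_
  rw [← holds_χ_iff i]
  exact iff_of_eq (congrArg Holds (Category.assoc _ _ _).symm)

end GenericMono

/-! ### Definite description and the endpoint map in a topos. -/

section Topos

variable {C : Type u} [Category.{v} C] [CartesianMonoidalCategory C]

lemma toUnit_comp_eq {V W X : C} (w : W ⟶ V) (a : 𝟙_ C ⟶ X) :
    w ≫ toUnit V ≫ a = toUnit W ≫ a := by
  rw [← Category.assoc]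
  congr 1
  exact toUnit_unique _ _

variable [MonoidalClosed C] [HasFiniteLimits C] [HasSubobjectClassifier C]

/-- Definite description: if a relation `γ` between `X` and `B` is functional on the subobjects
of `B` that contain `b₀` and `b₁`, and no proper subobject does so, then it is the graph of a
morphism. -/
lemma exists_graph {X B : C} {Q : ∀ ⦃V : C⦄, (V ⟶ X ⊗ B) → Prop} (hQ : IsClassified Q)
    {ι : Type*} (b : ι → (𝟙_ C ⟶ B))
    (hB : ∀ (E : C) (i : E ⟶ B) [Mono i], (∀ k, Hits i (b k)) → Hits i (𝟙 B))
    (hb : ∀ k, ∃ a : 𝟙_ C ⟶ X, ∀ ⦃W : C⦄ (x : W ⟶ X),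
      Q (lift x (toUnit W ≫ b k)) ↔ x = toUnit W ≫ a) :
    ∃ l : B ⟶ X, Q (lift l (𝟙 B)) := by
  obtain ⟨γ, hγ⟩ := hQ
  let δ : X ⊗ X ⟶ Ω C := χ (lift (𝟙 X) (𝟙 X))
  have hδ : ∀ {V : C} (x y : V ⟶ X), Holds (lift x y ≫ δ) ↔ x = y := by
    intro V x y
    have : Mono (lift (𝟙 X) (𝟙 X)) := mono_of_mono_fac (lift_fst _ _)
    rw [holds_χ_iff]
    constructor
    · rintro ⟨k, hk⟩
      have h₁ := congrArg (fun t => t ≫ fst _ _) hk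
      have h₂ := congrArg (fun t => t ≫ snd _ _) hk
      simp only [Category.assoc, lift_fst, lift_snd, Category.comp_id] at h₁ h₂
      exact h₁.symm.trans h₂
    · rintro rfl
      exact ⟨x, by simp [comp_lift]⟩
  have hwhisker : ∀ {V W Y : C} (w : W ⟶ X ⊗ V) (y : V ⟶ Y),
      w ≫ X ◁ y = lift (w ≫ fst _ _) (w ≫ snd _ _ ≫ y) := by
    intro V W Y w y
    ext <;> simp
  -- The singleton map `x ↦ {x}` into the power object.
  let s : X ⟶ (ihom X).obj (Ω C) := MonoidalClosed.curry δ
  have hs : ∀ {V : C} (x : V ⟶ X) (y : V ⟶ B), x ≫ s = y ≫ MonoidalClosed.curry γ ↔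
      ∀ ⦃W : C⦄ (w : W ⟶ V) (z : W ⟶ X), z = w ≫ x ↔ Q (lift z (w ≫ y)) := by
    intro V x y
    rw [← MonoidalClosed.curry_natural_left, ← MonoidalClosed.curry_natural_left,
      MonoidalClosed.curry_injective.eq_iff]
    constructor
    · intro h W w z
      have := congrArg (fun t => lift z w ≫ t) h
      simp only [← Category.assoc, lift_whiskerLeft] at this
      rw [← hδ, this, hγ]
    · intro h
      refine eq_of_holds_iff fun W w => ?_
      rw [← Category.assoc, ← Category.assoc, hwhisker, hwhisker, hδ, hγ, ← Category.assoc,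
        ← Category.assoc]
      exact h _ _
  have hsmono : Mono s := by
    refine ⟨fun x y h => ?_⟩
    rw [← MonoidalClosed.curry_natural_left, ← MonoidalClosed.curry_natural_left,
      MonoidalClosed.curry_injective.eq_iff] at h
    have := congrArg (fun t => lift x (𝟙 _) ≫ t) h
    simp only [← Category.assoc, lift_whiskerLeft, Category.id_comp] at this
    rw [← hδ, ← this, hδ]
  -- Pulling the singleton map back along the transpose of `γ` gives the subobject of those points
  -- of `B` whose fibre under `Q` is a singleton. It contains every `b k`, so it is everything.
  obtain ⟨k, hk⟩ := hB _ (pullback.snd s (MonoidalClosed.curry γ)) fun i => by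
    obtain ⟨a, ha⟩ := hb i
    refine ⟨pullback.lift a (b i) ((hs _ _).2 fun W w z => ?_), pullback.lift_snd _ _ _⟩
    rw [toUnit_unique w (toUnit W), ha]
  refine ⟨k ≫ pullback.fst _ _, ?_⟩
  have h := (hs (k ≫ pullback.fst s (MonoidalClosed.curry γ)) (𝟙 B)).1 (by
    rw [Category.assoc, pullback.condition, reassoc_of% hk, Category.id_comp]) (𝟙 _)
    (k ≫ pullback.fst _ _)
  simpa using h

variable [HasFiniteColimits C]

/-- If every subobject that contains two points is everything, then these points are the components
of a regular epimorphism. -/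
lemma isRegularEpi_coprodDesc {B : C} (b₀ b₁ : 𝟙_ C ⟶ B)
    (hB : ∀ (E : C) (i : E ⟶ B) [Mono i], Hits i b₀ → Hits i b₁ → Hits i (𝟙 B)) :
    IsRegularEpi (coprod.desc b₀ b₁) := by
  -- The equalizer of `f` and `g` contains both points, so it is everything.
  have uniq : ∀ {X : C} (f g : B ⟶ X), b₀ ≫ f = b₀ ≫ g → b₁ ≫ f = b₁ ≫ g → f = g := by
    intro X f g h₀ h₁
    obtain ⟨k, hk⟩ := hB _ (equalizer.ι f g) ⟨equalizer.lift _ h₀, equalizer.lift_ι _ _⟩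
      ⟨equalizer.lift _ h₁, equalizer.lift_ι _ _⟩
    rw [← Category.id_comp f, ← Category.id_comp g, ← hk, Category.assoc, equalizer.condition,
      Category.assoc]
  let e := coprod.desc b₀ b₁
  have desc : ∀ {X : C} (h : 𝟙_ C ⨿ 𝟙_ C ⟶ X), pullback.fst e e ≫ h = pullback.snd e e ≫ h →
      ∃ l : B ⟶ X, e ≫ l = h := by
    intro X h hh
    have glue : ∀ {V : C} (x y : V ⟶ 𝟙_ C ⨿ 𝟙_ C), x ≫ e = y ≫ e → x ≫ h = y ≫ h := by
      intro V x y hxy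
      have := congrArg (fun t => pullback.lift x y hxy ≫ t) hh
      simpa [pullback.lift_fst_assoc, pullback.lift_snd_assoc] using this
    let c : Bool → (𝟙_ C ⟶ 𝟙_ C ⨿ 𝟙_ C) := fun k => bif k then coprod.inr else coprod.inl
    -- The two points may coincide at some stages; there the kernel pair condition makes the
    -- prescribed values agree.
    have hglue : ∀ {V : C} (k k' : Bool), toUnit V ≫ c k ≫ e = toUnit V ≫ c k' ≫ e →
        toUnit V ≫ c k ≫ h = toUnit V ≫ c k' ≫ h := by
      intro V k k' hk
      have := glue (toUnit V ≫ c k) (toUnit V ≫ c k') (by simpa using hk)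
      simpa using this
    -- The graph of the descended map is "if `b` is the point `k`, then `x` is the value of `h` at
    -- `k`", for both `k`. It need only be functional at the two points.
    have hcl : ∀ k, IsClassified fun V (p : V ⟶ X ⊗ B) => ∀ ⦃W : C⦄ (w : W ⟶ V),
        (w ≫ p) ≫ snd _ _ = (w ≫ p) ≫ toUnit _ ≫ c k ≫ e →
        (w ≫ p) ≫ fst _ _ = (w ≫ p) ≫ toUnit _ ≫ c k ≫ h := fun k =>
      (isClassified_eq _ _).imp (isClassified_eq _ _)
    obtain ⟨l, hl₀, hl₁⟩ := exists_graph ((hcl false).and (hcl true)) (fun k => c k ≫ e)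
      (fun E i _ hi => hB E i ((coprod.inl_desc b₀ b₁).subst (hi false))
        ((coprod.inr_desc b₀ b₁).subst (hi true)))
      (fun k => ⟨c k ≫ h, fun W x => by
        have key : ∀ k', (∀ ⦃W' : C⦄ (w : W' ⟶ W),
            (w ≫ lift x (toUnit W ≫ c k ≫ e)) ≫ snd _ _ =
              (w ≫ lift x (toUnit W ≫ c k ≫ e)) ≫ toUnit _ ≫ c k' ≫ e →
            (w ≫ lift x (toUnit W ≫ c k ≫ e)) ≫ fst _ _ =
              (w ≫ lift x (toUnit W ≫ c k ≫ e)) ≫ toUnit _ ≫ c k' ≫ h) ↔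
            (∀ ⦃W' : C⦄ (w : W' ⟶ W), toUnit W' ≫ c k ≫ e = toUnit W' ≫ c k' ≫ e →
              w ≫ x = toUnit W' ≫ c k' ≫ h) := by
          intro k'
          simp only [comp_lift, lift_snd, lift_fst, toUnit_comp_eq]
        have main : ((∀ ⦃W' : C⦄ (w : W' ⟶ W), toUnit W' ≫ c k ≫ e = toUnit W' ≫ c false ≫ e →
              w ≫ x = toUnit W' ≫ c false ≫ h) ∧
            (∀ ⦃W' : C⦄ (w : W' ⟶ W), toUnit W' ≫ c k ≫ e = toUnit W' ≫ c true ≫ e →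
              w ≫ x = toUnit W' ≫ c true ≫ h)) ↔ x = toUnit W ≫ c k ≫ h := by
          constructor
          · rintro ⟨h₁, h₂⟩
            cases k
            · simpa using h₁ (𝟙 W) rfl
            · simpa using h₂ (𝟙 W) rfl
          · rintro rfl
            exact ⟨fun W' w hw => by rw [toUnit_comp_eq]; exact hglue _ _ hw,
              fun W' w hw => by rw [toUnit_comp_eq]; exact hglue _ _ hw⟩
        exact (and_congr (key false) (key true)).trans main⟩)
    have hl : ∀ k, (∀ ⦃W : C⦄ (w : W ⟶ B),
        (w ≫ lift l (𝟙 B)) ≫ snd _ _ = (w ≫ lift l (𝟙 B)) ≫ toUnit _ ≫ c k ≫ e →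
        (w ≫ lift l (𝟙 B)) ≫ fst _ _ = (w ≫ lift l (𝟙 B)) ≫ toUnit _ ≫ c k ≫ h) →
        (c k ≫ e) ≫ l = c k ≫ h := by
      intro k hk
      have := hk (c k ≫ e)
      simp only [comp_lift, lift_snd, lift_fst, toUnit_comp_eq, Category.comp_id] at this
      rw [toUnit_unique (toUnit (𝟙_ C)) (𝟙 _), Category.id_comp, Category.id_comp] at this
      exact this rfl
    refine ⟨l, coprod.hom_ext ?_ ?_⟩
    · simpa [c] using hl false hl₀
    · simpa [c] using hl true hl₁
  refine ⟨⟨{ W := pullback e e, left := pullback.fst e e, right := pullback.snd e e,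
             w := pullback.condition, isColimit := ?_ }⟩⟩
  refine Cofork.IsColimit.mk _ (fun s => (desc s.π s.condition).choose)
    (fun s => (desc s.π s.condition).choose_spec) (fun s l hl => ?_)
  have hl' : e ≫ l = s.π := hl
  have h := (desc s.π s.condition).choose_spec.trans hl'.symm
  refine uniq _ _ ?_ ?_
  · exact ((coprod.inl_desc_assoc b₀ b₁ _).symm.trans
      (congrArg (fun t => coprod.inl ≫ t) h.symm)).trans
      (coprod.inl_desc_assoc b₀ b₁ _)
  · exact ((coprod.inr_desc_assoc b₀ b₁ _).symm.trans
      (congrArg (fun t => coprod.inr ≫ t) h.symm)).trans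
      (coprod.inr_desc_assoc b₀ b₁ _)

/-- Two different Kan fibration structures on `Z` whose restrictions agree. -/
theorem LinearInterval.exists_kanStructure (𝕀 : LinearInterval C) (h : 𝕀.NonTrivial) :
    ∃ s t : 𝕀.KanStructure 𝕀.Z, s ≠ t ∧
      s.reindex 𝕀.T₀ = t.reindex 𝕀.T₀ ∧ s.reindex 𝕀.T₁ = t.reindex 𝕀.T₁ := by
  let d : Fin 2 → (𝟙_ C ⟶ 𝕀.I) := ![𝕀.zero, 𝕀.one]
  have hd : 𝕀.δ = fun i => Arrow.mk (d i) := by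
    funext i
    fin_cases i <;> rfl
  have : ∀ i, Mono (d i) := fun i => ⟨fun a b _ => toUnit_unique _ _⟩
  unfold KanStructure
  rw [hd]
  obtain ⟨s, t, h₀, h₁, hst⟩ := 𝕀.exists_liftingStructure d 0 (fun V x hx => by
    obtain ⟨k, rfl⟩ := hx
    rw [toUnit_unique k (toUnit V)]
    rfl) (isCartesianMono_genericMono (C := C))
  refine ⟨s, t, fun e => h (isRegularEpi_coprodDesc _ _ fun E i _ hi₀ hi₁ => ?_), h₀, h₁⟩
  obtain ⟨σ, x, u, hu, hits⟩ := exists_genericMono i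
  have key := hst e σ x (fun V y hy => (hits y).2 (hy ▸ hi₀.precomp _))
    (fun V y hy => (hits y).2 (hy ▸ hi₁.precomp _))
  have := (hits u).1 ((Category.comp_id u).subst (motive := Hits _) (key.precomp u))
  rwa [hu] at this

end Topos

/-! ### The simplicial interval and the four families of pushout products. -/

section SimplicialInterval

lemma hits_ι_iff {X V : SSet.{w}} (A : X.Subcomplex) (b : V ⟶ X) :
    Hits A.ι b ↔ ∀ (n : SimplexCategoryᵒᵖ) (x : V.obj n), b.app n x ∈ A.obj n := by
  constructor
  · rintro ⟨k, rfl⟩ n x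
    exact (k.app n x).2
  · intro h
    refine ⟨SSet.Subcomplex.lift b ?_, rfl⟩
    rintro n _ ⟨x, rfl⟩
    exact h n x

open SSet.stdSimplex in
lemma asOrderHom_ext {n : ℕ} {d : SimplexCategoryᵒᵖ} {x y : (Δ[n] : SSet.{w}).obj d}
    (h : ∀ i, asOrderHom x i = asOrderHom y i) : x = y :=
  SSet.stdSimplex.objEquiv.injective (SimplexCategory.Hom.ext _ _ (OrderHom.ext _ _ (funext h)))

open SSet.stdSimplex in
/-- Two monotone maps from a finite linear order to `{0, 1}` are comparable. -/
lemma asOrderHom_le_total {d : SimplexCategoryᵒᵖ} (x y : (Δ[1] : SSet.{w}).obj d) :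
    (∀ i, asOrderHom x i ≤ asOrderHom y i) ∨ (∀ i, asOrderHom y i ≤ asOrderHom x i) := by
  by_contra! h
  obtain ⟨⟨i, hi⟩, ⟨j, hj⟩⟩ := h
  have h₁ := (asOrderHom x).monotone (a := i) (b := j)
  have h₂ := (asOrderHom y).monotone (a := j) (b := i)
  rcases le_total i j with h | h
  · have := h₁ h
    omega
  · have := h₂ h
    omega

open SSet.stdSimplex in
/-- The order relation of the simplicial interval. -/
def simplicialLE : (Δ[1] ⊗ Δ[1] : SSet.{w}).Subcomplex where
  obj _ := {x | ∀ i, asOrderHom x.1 i ≤ asOrderHom x.2 i}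
  map f _ hx i := hx (f.unop.toOrderHom i)

lemma hits_simplicialLE_iff {V : SSet.{w}} (x y : V ⟶ Δ[1]) :
    Hits simplicialLE.ι (lift x y) ↔ ∀ (n : SimplexCategoryᵒᵖ) (v : V.obj n) (i),
      SSet.stdSimplex.asOrderHom (x.app n v) i ≤ SSet.stdSimplex.asOrderHom (y.app n v) i :=
  hits_ι_iff _ _

/-- The vertices of the simplicial interval, as constant maps. -/
def vertex (i : Fin 2) (V : SSet.{w}) : V ⟶ Δ[1] := SSet.const (SSet.stdSimplex.obj₀Equiv.symm i)

lemma comp_vertex {V W : SSet.{w}} (f : V ⟶ W) (i : Fin 2) : f ≫ vertex i W = vertex i V := rfl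

/-- Pairs of comparable simplices are jointly epimorphic. -/
lemma simplicialLE_hom_ext {X : SSet.{w}} {a b : (Δ[1] ⊗ Δ[1] : SSet.{w}) ⟶ X}
    (h₁ : simplicialLE.ι ≫ a = simplicialLE.ι ≫ b)
    (h₂ : (simplicialLE.ι ≫ lift (snd Δ[1] Δ[1]) (fst Δ[1] Δ[1])) ≫ a =
      (simplicialLE.ι ≫ lift (snd Δ[1] Δ[1]) (fst Δ[1] Δ[1])) ≫ b) : a = b := by
  ext n ⟨x, y⟩
  rcases asOrderHom_le_total x y with h | h
  · exact ConcreteCategory.congr_hom (congrArg (fun t => t.app n) h₁) ⟨(x, y), h⟩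
  · exact ConcreteCategory.congr_hom (congrArg (fun t => t.app n) h₂) ⟨(y, x), h⟩

/-- The simplicial interval `Δ[1]`, ordered pointwise. -/
noncomputable def simplicialInterval : LinearInterval SSet.{w} where
  I := Δ[1]
  R := simplicialLE
  le := simplicialLE.ι
  zero := vertex 0 _
  one := vertex 1 _
  le_refl x := (hits_simplicialLE_iff x x).2 fun _ _ _ => le_rfl
  le_trans x y z h₁ h₂ := (hits_simplicialLE_iff x z).2 fun n v i =>
    ((hits_simplicialLE_iff x y).1 h₁ n v i).trans ((hits_simplicialLE_iff y z).1 h₂ n v i)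
  le_antisymm x y h₁ h₂ := by
    ext n v
    exact asOrderHom_ext fun i => le_antisymm ((hits_simplicialLE_iff x y).1 h₁ n v i)
      ((hits_simplicialLE_iff y x).1 h₂ n v i)
  le_total := by
    refine ⟨fun a b h => simplicialLE_hom_ext ?_ ?_⟩
    · exact (coprod.inl_desc_assoc _ _ _).symm.trans ((congrArg (fun t => coprod.inl ≫ t) h).trans
        (coprod.inl_desc_assoc _ _ _))
    · exact (coprod.inr_desc_assoc _ _ _).symm.trans ((congrArg (fun t => coprod.inr ≫ t) h).trans
        (coprod.inr_desc_assoc _ _ _))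
  zero_le x := (hits_simplicialLE_iff _ x).2 fun _ _ _ => Fin.zero_le _
  le_one x := (hits_simplicialLE_iff x _).2 fun _ _ _ => Fin.le_last _

/-- Lifting structures on the simplicial interval family are determined by their restrictions
if the lifting notion is definable. -/
lemma eq_of_reindex_simplicialInterval_eq {J : Type u₁} [Category.{v₁} J] {m : J ⥤ Arrow SSet.{w}}
    (h : (liftingNotion m).Definable)
    {s t : LiftingStructure m (simplicialInterval.{w}).Z}
    (h₀ : s.reindex simplicialInterval.T₀ = t.reindex simplicialInterval.T₀)
    (h₁ : s.reindex simplicialInterval.T₁ = t.reindex simplicialInterval.T₁) : s = t :=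
  eq_of_reindex_eq h (ι := Bool)
    (Y := fun _ => (simplicialInterval.{w}).R)
    (fun i => bif i then simplicialInterval.T₁ else simplicialInterval.T₀)
    (fun _ _ _ h => simplicialLE_hom_ext (h true) (h false))
    (Bool.forall_bool.2 ⟨h₀, h₁⟩)

/-- A simplex constant at the vertex `i` misses the vertex `1 - i`. -/
lemma hits_boundary_one {V : SSet.{w}} {x : V ⟶ Δ[1]} (i : Fin 2) (hx : x = vertex i V) :
    Hits (SSet.boundary.{w} 1).ι x := by
  subst hx
  refine (hits_ι_iff _ _).2 fun n v h => ?_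
  obtain ⟨k, hk⟩ := h (1 - i)
  have : i = 1 - i := hk
  omega

lemma not_hits_boundary (n : ℕ) : ¬ Hits (SSet.boundary.{w} n).ι (𝟙 _) := fun h =>
  SSet.stdSimplex.notMem_boundary n ((hits_ι_iff _ _).1 h _ _)

/-- Kan fibration structures in simplicial sets are not definable, if the inclusion of the boundary
of the interval is a generating monomorphism. -/
lemma not_definable_kanMaps {J : Type u₁} [Category.{v₁} J] {m : J ⥤ Arrow SSet.{w}}
    (hm : IsCartesianMono m) (j : J) (e : (m.obj j).right ⟶ Δ[1]) (u : Δ[1] ⟶ (m.obj j).right)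
    (hu : u ≫ e = 𝟙 _)
    (he : ∀ ⦃V : SSet.{w}⦄ (x : V ⟶ (m.obj j).right),
      Hits (m.obj j).hom x ↔ Hits (SSet.boundary 1).ι (x ≫ e)) :
    ¬ (liftingNotion (kanMaps endpoint.{w} m)).Definable := by
  intro h
  let d (i : Fin 2) : Δ[0] ⟶ (simplicialInterval.{w}).I := SSet.stdSimplex.δ i
  have (i : Fin 2) : Mono (d i) := ⟨fun _ _ _ => SSet.stdSimplex.ext₀⟩
  -- The index is `1` because `δ 1` omits the vertex `1`, so it is the endpoint `0`.
  obtain ⟨s, t, h₀, h₁, hst⟩ := (simplicialInterval.{w}).exists_liftingStructure d 1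
    (fun V x hx => by
      obtain ⟨k, rfl⟩ := hx
      exact congrArg (k ≫ ·) SSet.stdSimplex.δ_one_eq_const) hm
  have key := hst (eq_of_reindex_simplicialInterval_eq h h₀ h₁) j e
    (fun V x hx => (he x).2 (hits_boundary_one 0 hx))
    (fun V x hx => (he x).2 (hits_boundary_one 1 hx))
  have := (he u).1 ((Category.comp_id u).subst (motive := Hits _) (key.precomp u))
  rw [hu] at this
  exact not_hits_boundary 1 this

lemma isCartesianMono_setFamily {C : Type u} [Category.{v} C] {ι : Type w} (g : ι → Arrow C)
    (hg : ∀ i, Mono (g i).hom) : IsCartesianMono (setFamily g) where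
  mono j := hg j.as
  hits := by
    rintro ⟨i⟩ ⟨i'⟩ k W b h
    obtain rfl := Discrete.eq_of_hom k
    obtain rfl : k = 𝟙 _ := Subsingleton.elim _ _
    rw [CategoryTheory.Functor.map_id] at h
    exact (Category.comp_id b).subst (motive := Hits _) h

lemma IsCartesianMono.comp {C : Type u} [Category.{v} C] {J : Type u₁} [Category.{v₁} J]
    {K : Type u₂} [Category.{v₂} K] {m : J ⥤ Arrow C} (hm : IsCartesianMono m) (F : K ⥤ J) :
    IsCartesianMono (F ⋙ m) where
  mono j := hm.mono (F.obj j)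
  hits k _ b h := hm.hits (F.map k) b h

theorem not_definable_genericMono :
    ¬ (liftingNotion (kanMaps endpoint.{w} (genericMono SSet.{w}))).Definable := by
  obtain ⟨σ, e, u, hu, he⟩ := exists_genericMono (SSet.boundary.{w} 1).ι
  exact not_definable_kanMaps isCartesianMono_genericMono σ e u hu he

theorem not_definable_subobjectsOfRepresentables :
    ¬ (liftingNotion
      (kanMaps endpoint.{w} (setFamily subobjectsOfRepresentables.{w}))).Definable :=
  not_definable_kanMaps (isCartesianMono_setFamily _ fun a => inferInstanceAs (Mono a.2.ι))
    ⟨⟨1, SSet.boundary 1⟩⟩ (𝟙 _) (𝟙 _) (Category.comp_id _) fun _ x =>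
      iff_of_eq (congrArg (Hits _) (Category.comp_id x).symm)

theorem not_definable_boundaryInclusion :
    ¬ (liftingNotion (kanMaps endpoint.{w} (setFamily boundaryInclusion.{w}))).Definable :=
  not_definable_kanMaps (isCartesianMono_setFamily _ fun n =>
      inferInstanceAs (Mono (SSet.boundary n).ι))
    ⟨1⟩ (𝟙 _) (𝟙 _) (Category.comp_id _) fun _ x =>
      iff_of_eq (congrArg (Hits _) (Category.comp_id x).symm)

/-- Classically every set of simplices has a complement. Hence `Ω_dec` is all of `Ω`, and the
decidable case reduces to the generic one. -/
lemma mem_decidableΩ {n : SimplexCategoryᵒᵖ} (ω : (Ω SSet.{w}).obj n) :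
    ω ∈ decidableΩ.obj n :=
  fun _ => ⟨_, isCompl_compl⟩

theorem not_definable_genericDecidableMono :
    ¬ (liftingNotion (kanMaps endpoint.{w} genericDecidableMono.{w})).Definable := by
  obtain ⟨σ, e, u, hu, he⟩ := exists_genericMono (SSet.boundary.{w} 1).ι
  obtain ⟨k, hk⟩ := (hits_ι_iff decidableΩ.{w} σ.hom).2 fun n x => mem_decidableΩ _
  obtain ⟨τ, rfl⟩ : ∃ τ, (Over.map decidableΩ.{w}.ι).obj τ = σ :=
    ⟨Over.mk k, congrArg Over.mk hk⟩
  exact not_definable_kanMaps (isCartesianMono_genericMono.comp (Over.map decidableΩ.{w}.ι))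
    τ e u hu he

end SimplicialInterval

/-! ### Regions relative to a fibre projection, and horn inclusions. -/

section Horns

/-- The generalised elements of the domains of a cartesian diagram of monomorphisms. -/
def IsCartesianMono.generatingElements {C : Type u} [Category.{v} C] [HasFiniteLimits C]
    [HasSubobjectClassifier C] {J : Type u₁} [Category.{v₁} J]
    {m : J ⥤ Arrow C} (hm : IsCartesianMono m) : GeneratingElements m where
  mem _ _ _ := True
  precomp _ _ := trivial
  hom_ext h := by simpa using h (𝟙 _) trivial
  inj {j _ _ _} _ _ h := by
    have := hm.mono j
    exact (cancel_mono (m.obj j).hom).1 h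
  map _ _ _ _ := trivial
  cart k _ b q _ h := by
    obtain ⟨q', hq'⟩ := hm.hits k b ⟨q, h⟩
    exact ⟨q', trivial, hq'⟩
  classified j ζ := by
    have := hm.mono j
    exact (isClassified_forall_of_mono (m.obj j).hom ζ).congr fun V b =>
      ⟨fun h W w q _ e => h w q e, fun h W w q e => h w q trivial e⟩

/-- A natural projection of the codomains of the maps `m j` to objects `base j`, such that the
naturality squares are pullbacks. -/
structure FibreProjection {C : Type u} [Category.{v} C] {J : Type u₁} [Category.{v₁} J]
    (m : J ⥤ Arrow C) where
  /-- the target of the projection -/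
  base : J → C
  /-- the projection -/
  pr (j : J) : (m.obj j).right ⟶ base j
  map_eq : ∀ {j j' : J} (k : j ⟶ j') {V : C} (b c : V ⟶ (m.obj j).right), b ≫ pr j = c ≫ pr j →
    b ≫ (m.map k).right ≫ pr j' = c ≫ (m.map k).right ≫ pr j'
  exists_lift : ∀ {j j' : J} (k : j ⟶ j') {V : C} (b : V ⟶ (m.obj j').right)
    (c : V ⟶ (m.obj j).right), b ≫ pr j' = c ≫ (m.map k).right ≫ pr j' →
    ∃ a : V ⟶ (m.obj j).right, a ≫ (m.map k).right = b ∧ a ≫ pr j = c ≫ pr j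

/-- A property of simplices that is stable under restriction defines a subobject. -/
lemma isClassified_forall_simplex {B : SSet.{w}}
    {Q : ∀ n : SimplexCategory, (SSet.stdSimplex.obj n ⟶ B) → Prop}
    (hQ : ∀ {n n' : SimplexCategory} (f : n' ⟶ n) (x : SSet.stdSimplex.obj n ⟶ B), Q n x →
      Q n' (SSet.stdSimplex.map f ≫ x)) :
    IsClassified fun V (b : V ⟶ B) =>
      ∀ (n : SimplexCategory) (x : SSet.stdSimplex.obj n ⟶ V), Q n (x ≫ b) := by
  let A : B.Subcomplex :=
    { obj n := {s | Q n.unop (SSet.yonedaEquiv.symm s)}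
      map f s hs := by
        have := hQ f.unop _ hs
        rwa [SSet.yonedaEquiv_symm_naturality_left] at this }
  refine (isClassified_hits A.ι).congr fun V b => (hits_ι_iff A b).trans ?_
  have key : ∀ (n : SimplexCategory) (x : SSet.stdSimplex.obj n ⟶ V),
      b.app (op n) (SSet.yonedaEquiv x) ∈ A.obj (op n) ↔ Q n (x ≫ b) := fun n x => by
    change Q n (SSet.yonedaEquiv.symm (SSet.yonedaEquiv (x ≫ b))) ↔ _
    rw [Equiv.symm_apply_apply]
  constructor
  · intro h n x
    exact (key n x).1 (h _ _)
  · intro h n x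
    obtain ⟨y, rfl⟩ := SSet.yonedaEquiv.surjective x
    exact (key n.unop y).2 (h _ _)

variable {J : Type u₁} [Category.{v₁} J] {m : J ⥤ Arrow SSet.{w}}

/-- The region of those simplices `x` which belong to the subobject `m j`, or to `T₀`, or whose
whole fibre belongs to `T₁`. -/
noncomputable def FibreProjection.region (P : FibreProjection m) (hm : IsCartesianMono m)
    {Y R₀ R₁ : SSet.{w}} (T₀ : R₀ ⟶ Y) (T₁ : R₁ ⟶ Y) : Region hm.generatingElements T₀ where
  -- The disjunction is taken simplex by simplex, as unions of subcomplexes are. The fibrewise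
  -- clause refers to all `W` over the simplex, which makes it stable under restriction.
  mem j p V b := ∀ (n : SimplexCategory) (x : SSet.stdSimplex.obj n ⟶ V),
    Hits (m.obj j).hom (x ≫ b) ∨ Hits T₀ ((x ≫ b) ≫ p) ∨
      ∀ ⦃W : SSet.{w}⦄ (w : W ⟶ SSet.stdSimplex.obj n) (b' : W ⟶ (m.obj j).right),
        b' ≫ P.pr j = w ≫ (x ≫ b) ≫ P.pr j → Hits T₁ (b' ≫ p)
  classified j p := by
    refine isClassified_forall_simplex (Q := fun n y => Hits (m.obj j).hom y ∨ Hits T₀ (y ≫ p) ∨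
      ∀ ⦃W : SSet.{w}⦄ (w : W ⟶ SSet.stdSimplex.obj n) (b' : W ⟶ (m.obj j).right),
        b' ≫ P.pr j = w ≫ y ≫ P.pr j → Hits T₁ (b' ≫ p)) fun f y h => ?_
    refine h.imp (fun h => h.precomp _) (Or.imp (fun h => ?_) fun h W w b' e => ?_)
    · rw [Category.assoc]
      exact h.precomp _
    · exact h (w ≫ SSet.stdSimplex.map f) b' (by simpa using e)
  natural {j j'} k p V b := by
    refine forall₂_congr fun n x => or_congr ?_ (or_congr ?_ ?_)
    · rw [← Category.assoc]
      exact (hm.hits_iff k _).symm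
    · simp only [Category.assoc]
    · constructor
      · intro h W w b' e
        -- Every point of the fibre in the target comes from the corresponding fibre in the source,
        -- so "the whole fibre lies in `T₁`" is natural.
        obtain ⟨a, rfl, ha⟩ := P.exists_lift k b' (w ≫ x ≫ b) (by simpa using e)
        simpa using h w a (by simpa using ha)
      · intro h W w b' e
        simpa using h w (b' ≫ (m.map k).right) (by
          simpa using P.map_eq k b' (w ≫ x ≫ b) (by simpa using e))
  of_mem p V q _ n x := Or.inl ⟨x ≫ q, Category.assoc _ _ _⟩
  of_hits p V b h n x := Or.inr (Or.inl (by
    rw [Category.assoc]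
    exact h.precomp x))

/-- Lifting structures against a cartesian diagram of monomorphisms are not definable, if for some
`p` from the codomain of a generating map to the square of the interval, the image of the
map lies over `{y = 0}`, and the diagonal sections `(x, 0)` and `(x, 1)` lift to sections with the
same projection. -/
lemma FibreProjection.not_definable (P : FibreProjection m) (hm : IsCartesianMono m) (j : J)
    (p : (m.obj j).right ⟶ Δ[1] ⊗ Δ[1]) (hp : (m.obj j).hom ≫ p ≫ snd _ _ = vertex 0 _)
    (b₀ b₁ : Δ[1] ⟶ (m.obj j).right) (hb : b₀ ≫ P.pr j = b₁ ≫ P.pr j)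
    (hb₀ : b₀ ≫ p = lift (𝟙 _) (vertex 0 _)) (hb₁ : b₁ ≫ p = lift (𝟙 _) (vertex 1 _)) :
    ¬ (liftingNotion m).Definable := by
  intro h
  let 𝕀 := simplicialInterval.{w}
  let F := 𝕀.truthFamily
  let ρ := P.region hm 𝕀.T₀ 𝕀.T₁
  have h₀ : ((Region.top _ _).liftingStructure F).reindex 𝕀.T₀ =
      (ρ.liftingStructure F).reindex 𝕀.T₀ :=
    Region.reindex_eq_of_mem_iff F (R := 𝕀.R) 𝕀.T₀ fun j p V b =>
      iff_of_true trivial (ρ.of_hits _ ⟨b ≫ p, Category.assoc _ _ _⟩)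
  have h₁ : ((Region.top _ _).liftingStructure F).reindex 𝕀.T₁ =
      (ρ.liftingStructure F).reindex 𝕀.T₁ :=
    Region.reindex_eq_of_mem_iff F (R := 𝕀.R) 𝕀.T₁ fun j p V b =>
      iff_of_true trivial fun n x => Or.inr (Or.inr fun W w b' _ => ⟨b' ≫ p, Category.assoc _ _ _⟩)
  have hmem : ρ.mem j p b₁ := (Region.mem_iff_of_liftingStructure_eq F
    (eq_of_reindex_simplicialInterval_eq h h₀ h₁) j p b₁).1 trivial
  -- The section `b₁` satisfies no clause on the identity simplex: its second coordinate is `1`, not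
  -- `0`; `x ≥ 1` fails at `x = 0`; and its fibre contains `b₀`, for which `x ≤ 0` fails at `x = 1`.
  rcases hmem ⦋1⦌ (𝟙 _) with ⟨a, ha⟩ | ⟨a, ha⟩ | H
  · have e : vertex 0 _ = vertex 1 Δ[1] := by
      have := congrArg (fun t => t ≫ p ≫ snd _ _) ha
      rw [Category.id_comp, ← Category.assoc b₁, hb₁, lift_snd, Category.assoc, hp] at this
      exact this
    have := congrArg (fun f => SSet.stdSimplex.asOrderHom
      (f.app (op ⦋0⦌) (SSet.stdSimplex.obj₀Equiv.symm 0)) 0) e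
    exact absurd this (by decide : (0 : Fin 2) ≠ 1)
  · have e : Hits 𝕀.T₀ (lift (𝟙 𝕀.I) (vertex 1 _)) :=
      ⟨a, ha.trans ((congrArg (· ≫ p) (Category.id_comp b₁)).trans hb₁)⟩
    have := (hits_simplicialLE_iff (vertex 1 _) (𝟙 Δ[1])).1 ((𝕀.hits_T₀_iff _ _).1 e) (op ⦋0⦌)
      (SSet.stdSimplex.obj₀Equiv.symm 0) 0
    exact absurd this (by decide : ¬ (1 : Fin 2) ≤ 0)
  · have := H (𝟙 _) b₀ (by simpa using hb)
    have := (hits_simplicialLE_iff (𝟙 Δ[1]) (vertex 0 _)).1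
      (hb₀.subst (motive := Hits _) this) (op ⦋0⦌)
      (SSet.stdSimplex.obj₀Equiv.symm 1) 0
    exact absurd this (by decide : ¬ (1 : Fin 2) ≤ 0)

/-- The horn inclusion of a vertex into the interval. -/
lemma horn_one_ι : (SSet.horn.{w} 1 0).ι = vertex 0 _ := by
  ext n ⟨x, hx⟩
  refine asOrderHom_ext fun i => ?_
  by_contra h
  -- A nonzero value would make the range of `x` together with the vertex `0` everything, which
  -- membership in the horn excludes.
  refine hx (Set.eq_univ_of_forall fun k => ?_)
  change SSet.stdSimplex.asOrderHom x i ≠ 0 at h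
  by_cases hk : k = 0
  · exact Or.inr hk
  · exact Or.inl ⟨i, by omega⟩

lemma mono_hornInclusion (i) : Mono (hornInclusion.{w} i).hom :=
  inferInstanceAs (Mono (SSet.horn (i.1 + 1) i.2).ι)

/-! ### Enriched families. -/

section Enriched

variable {C : Type u} [Category.{v} C] [CartesianMonoidalCategory C] {ι : Type w}
  {g : ι → Arrow C}

namespace enrichedMaps

/-- The projection `U × A i ⟶ U`. -/
def leftFst (g : ι → Arrow C) (j : Discrete ι × C) : ((enrichedMaps g).obj j).left ⟶ j.2 :=
  fst j.2 (g j.1.as).left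

/-- The projection `U × A i ⟶ A i`. -/
def leftSnd (g : ι → Arrow C) (j : Discrete ι × C) :
    ((enrichedMaps g).obj j).left ⟶ (g j.1.as).left :=
  snd j.2 (g j.1.as).left

/-- The projection `U × B i ⟶ U`. -/
def rightFst (g : ι → Arrow C) (j : Discrete ι × C) : ((enrichedMaps g).obj j).right ⟶ j.2 :=
  fst j.2 (g j.1.as).right

/-- The projection `U × B i ⟶ B i`. -/
def rightSnd (g : ι → Arrow C) (j : Discrete ι × C) :
    ((enrichedMaps g).obj j).right ⟶ (g j.1.as).right :=
  snd j.2 (g j.1.as).right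

lemma left_ext {j : Discrete ι × C} {V : C} {a b : V ⟶ ((enrichedMaps g).obj j).left}
    (h₁ : a ≫ leftFst g j = b ≫ leftFst g j) (h₂ : a ≫ leftSnd g j = b ≫ leftSnd g j) : a = b :=
  CartesianMonoidalCategory.hom_ext _ _ h₁ h₂

lemma right_ext {j : Discrete ι × C} {V : C} {a b : V ⟶ ((enrichedMaps g).obj j).right}
    (h₁ : a ≫ rightFst g j = b ≫ rightFst g j) (h₂ : a ≫ rightSnd g j = b ≫ rightSnd g j) :
    a = b :=
  CartesianMonoidalCategory.hom_ext _ _ h₁ h₂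

lemma exists_left (j : Discrete ι × C) {V : C} (u : V ⟶ j.2) (x : V ⟶ (g j.1.as).left) :
    ∃ a : V ⟶ ((enrichedMaps g).obj j).left, a ≫ leftFst g j = u ∧ a ≫ leftSnd g j = x :=
  ⟨lift u x, lift_fst _ _, lift_snd _ _⟩

lemma exists_right (j : Discrete ι × C) {V : C} (u : V ⟶ j.2) (y : V ⟶ (g j.1.as).right) :
    ∃ a : V ⟶ ((enrichedMaps g).obj j).right, a ≫ rightFst g j = u ∧ a ≫ rightSnd g j = y :=
  ⟨lift u y, lift_fst _ _, lift_snd _ _⟩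

lemma hom_fst (j : Discrete ι × C) :
    ((enrichedMaps g).obj j).hom ≫ rightFst g j = leftFst g j :=
  whiskerLeft_fst _ _

lemma hom_snd (j : Discrete ι × C) :
    ((enrichedMaps g).obj j).hom ≫ rightSnd g j = leftSnd g j ≫ (g j.1.as).hom :=
  whiskerLeft_snd _ _

lemma map_right (i : ι) {U U' : C} (k : ((⟨i⟩, U) : Discrete ι × C) ⟶ (⟨i⟩, U')) :
    ((enrichedMaps g).map k).right = k.2 ▷ (g i).right := by
  obtain ⟨k₁, k₂⟩ := k
  obtain rfl : k₁ = 𝟙 _ := Subsingleton.elim _ _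
  exact Category.id_comp _

lemma map_right_fst (i : ι) {U U' : C} (k : ((⟨i⟩, U) : Discrete ι × C) ⟶ (⟨i⟩, U')) :
    ((enrichedMaps g).map k).right ≫ rightFst g (⟨i⟩, U') = rightFst g (⟨i⟩, U) ≫ k.2 := by
  rw [map_right]
  exact whiskerRight_fst _ _

lemma map_right_snd (i : ι) {U U' : C} (k : ((⟨i⟩, U) : Discrete ι × C) ⟶ (⟨i⟩, U')) :
    ((enrichedMaps g).map k).right ≫ rightSnd g (⟨i⟩, U') = rightSnd g (⟨i⟩, U) := by
  rw [map_right]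
  exact whiskerRight_snd _ _

end enrichedMaps

open enrichedMaps in
lemma isCartesianMono_enrichedMaps (hg : ∀ i, Mono (g i).hom) :
    IsCartesianMono (enrichedMaps g) where
  mono j := by
    have := hg j.1.as
    refine ⟨fun a b e => left_ext ?_ ((cancel_mono (g j.1.as).hom).1 ?_)⟩
    · rw [← hom_fst, reassoc_of% e]
    · rw [Category.assoc, Category.assoc, ← hom_snd, reassoc_of% e]
  hits := by
    rintro ⟨⟨i⟩, U⟩ ⟨⟨i'⟩, U'⟩ k W b ⟨a, ha⟩
    obtain rfl : i = i' := Discrete.eq_of_hom k.1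
    obtain ⟨c, hc₁, hc₂⟩ := exists_left (g := g) (⟨i⟩, U) (b ≫ rightFst g _) (a ≫ leftSnd g _)
    refine ⟨c, right_ext ?_ ?_⟩
    · rw [Category.assoc, hom_fst, hc₁]
    · rw [Category.assoc, hom_snd, reassoc_of% hc₂]
      have := congrArg (fun t => t ≫ rightSnd g (⟨i⟩, U')) ha
      simp only [Category.assoc, hom_snd, map_right_snd] at this
      exact this

open enrichedMaps in
/-- The projection `U × B i ⟶ U`. -/
noncomputable def enrichedMaps.fibreProjection (g : ι → Arrow C) :
    FibreProjection (enrichedMaps g) where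
  base j := j.2
  pr j := rightFst g j
  map_eq := by
    rintro ⟨⟨i⟩, U⟩ ⟨⟨i'⟩, U'⟩ k V b c h
    obtain rfl : i = i' := Discrete.eq_of_hom k.1
    rw [map_right_fst, reassoc_of% h]
  exists_lift := by
    rintro ⟨⟨i⟩, U⟩ ⟨⟨i'⟩, U'⟩ k V b c h
    obtain rfl : i = i' := Discrete.eq_of_hom k.1
    obtain ⟨a, ha₁, ha₂⟩ := exists_right (g := g) (⟨i⟩, U) (c ≫ rightFst g _) (b ≫ rightSnd g _)
    refine ⟨a, right_ext ?_ ?_, ha₁⟩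
    · rw [h, Category.assoc, map_right_fst, reassoc_of% ha₁]
    · rw [Category.assoc, map_right_snd, ha₂]

end Enriched

/-- The index `⟨0, 0⟩` is the horn `Λ[1, 0] = {0}`, since dimensions are shifted by one. With `U =
Δ[1]` and `p` the identity, its image is `{y = 0}`, and the sections `(x, 0)` and `(x, 1)` have the
same projection to `U`. -/
theorem not_definable_enrichedMaps :
    ¬ (liftingNotion (enrichedMaps hornInclusion.{w})).Definable := by
  refine (enrichedMaps.fibreProjection _).not_definable
    (isCartesianMono_enrichedMaps mono_hornInclusion) (⟨⟨0, 0⟩⟩, Δ[1]) (𝟙 (Δ[1] ⊗ Δ[1])) ?_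
    (lift (𝟙 Δ[1]) (vertex 0 _)) (lift (𝟙 Δ[1]) (vertex 1 _)) ?_ ?_ ?_
  · have : Δ[1] ◁ (SSet.horn.{w} 1 0).ι ≫ 𝟙 (Δ[1] ⊗ Δ[1]) ≫ snd _ _ = vertex 0 _ := by
      rw [Category.id_comp, whiskerLeft_snd, horn_one_ι, comp_vertex]
    exact this
  · exact (lift_fst _ _).trans (lift_fst _ _).symm
  · exact Category.comp_id _
  · exact Category.comp_id _

section Reindex

variable {C : Type u} [Category.{v} C] [HasPullbacks C] {I : C} {X Y : Over I}

/-- The projection of the codomain of `σ^* g` to that of `σ`. -/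
noncomputable def reindex.fibreProjection (g : X ⟶ Y) : FibreProjection (reindex g) where
  base σ := σ.left
  pr σ := reindex.rightSnd g σ
  map_eq k V b c h := by
    rw [reindex.map_right_snd, reassoc_of% h]
  exists_lift k V b c h := by
    rw [reindex.map_right_snd] at h
    obtain ⟨a, ha₁, ha₂⟩ := reindex.exists_right (g := g) (b ≫ reindex.rightFst g _)
      (c ≫ reindex.rightSnd g _) (by
        rw [Category.assoc, reindex.right_condition, reassoc_of% h, Over.w, Category.assoc])
    refine ⟨a, reindex.right_ext ?_ ?_, ha₂⟩
    · rw [Category.assoc, reindex.map_right_fst, ha₁]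
    · rw [Category.assoc, reindex.map_right_snd, reassoc_of% ha₂, h]

end Reindex

/-- Used to extend a map on one summand of a coproduct by a constant on the others. The reindexing
over that summand then need not be identified with a product, and no disjointness of coproducts is
required. -/
lemma exists_update {C : Type u} [Category.{v} C] {ι : Type*} (g : ι → Arrow C) {X : C}
    (z : ∀ i, (g i).right ⟶ X) (i₀ : ι) (f : (g i₀).right ⟶ X)
    (hf : (g i₀).hom ≫ f = (g i₀).hom ≫ z i₀) :
    ∃ d : ∀ i, (g i).right ⟶ X, d i₀ = f ∧ ∀ i, (g i).hom ≫ d i = (g i).hom ≫ z i := by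
  classical
  refine ⟨Function.update z i₀ f, Function.update_self .., fun i => ?_⟩
  by_cases hi : i = i₀
  · subst hi
    rw [Function.update_self, hf]
  · rw [Function.update_of_ne hi]

/-! ### The fibred coproduct of a set of maps. -/

section FibredCoproduct

variable {C : Type u} [Category.{v} C] [HasPullbacks C] [CartesianMonoidalCategory C] {ι : Type w}
  [HasColimitsOfShape (Discrete ι) C]

/-- The coproduct of a family of maps, as a vertical map over the coproduct of copies of the
terminal object. -/
noncomputable abbrev fibredCoproductHom (g : ι → Arrow C) :
    Over.mk (Limits.Sigma.map fun i => toUnit (g i).left) ⟶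
      Over.mk (Limits.Sigma.map fun i => toUnit (g i).right) :=
  Over.homMk (Limits.Sigma.map fun i => (g i).hom)
    (by apply Limits.Sigma.hom_ext; intro i; simp)

lemma isCartesianMono_fibredCoproduct (g : ι → Arrow C) (hg : ∀ i, Mono (g i).hom)
    [(MorphismProperty.monomorphisms C).IsStableUnderColimitsOfShape (Discrete ι)] :
    IsCartesianMono (fibredCoproduct g) :=
  isCartesianMono_reindex (inferInstanceAs (Mono (Limits.Sigma.map fun i => (g i).hom)))

/-- Each member of a family of maps is a reindexing of the coproduct, multiplied by any object `U`,
and a morphism `f` from its codomain that is constant on the domain extends to the whole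
coproduct. -/
lemma exists_fibredCoproduct (g : ι → Arrow C) (i₀ : ι) {X : C} (U : C) (z : 𝟙_ C ⟶ X)
    (f : (g i₀).right ⟶ X) (hf : (g i₀).hom ≫ f = toUnit _ ≫ z) :
    ∃ (σ : U ⟶ ∐ fun _ : ι => 𝟙_ C)
      (e : ((reindex (fibredCoproductHom g)).obj (Over.mk σ)).right ⟶ X),
      ((reindex (fibredCoproductHom g)).obj (Over.mk σ)).hom ≫ e = toUnit _ ≫ z ∧
      ∀ y : U ⟶ (g i₀).right, ∃ b : U ⟶ ((reindex (fibredCoproductHom g)).obj (Over.mk σ)).right,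
        b ≫ reindex.rightSnd (fibredCoproductHom g) (Over.mk σ) = 𝟙 U ∧ b ≫ e = y ≫ f := by
  obtain ⟨d, hd₀, hd⟩ := exists_update g (fun _ => toUnit _ ≫ z) i₀ f (by
    rw [hf, ← Category.assoc]
    congr 1
    exact toUnit_unique _ _)
  have hD : (Limits.Sigma.map fun i => (g i).hom) ≫ Limits.Sigma.desc d = toUnit _ ≫ z := by
    refine Limits.Sigma.hom_ext _ _ fun i => ?_
    rw [Limits.Sigma.ι_map_assoc, Limits.Sigma.ι_desc, hd, toUnit_comp_eq, toUnit_comp_eq]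
  -- Reindex along the constant map at the summand `i₀`, and let `e` be induced by the extension of
  -- `f` to the whole coproduct.
  refine ⟨toUnit U ≫ Limits.Sigma.ι (fun _ : ι => 𝟙_ C) i₀,
    reindex.rightFst (fibredCoproductHom g) _ ≫ Limits.Sigma.desc d, ?_, fun y => ?_⟩
  · rw [reassoc_of% (reindex.hom_fst (g := fibredCoproductHom g)),
      ← toUnit_comp_eq (reindex.leftFst (fibredCoproductHom g) _)]
    exact congrArg (fun t => reindex.leftFst (fibredCoproductHom g) _ ≫ t) hD
  · obtain ⟨b, hb₁, hb₂⟩ := reindex.exists_right (g := fibredCoproductHom g)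
      (σ := Over.mk (toUnit U ≫ Limits.Sigma.ι (fun _ : ι => 𝟙_ C) i₀))
      (y ≫ Limits.Sigma.ι (fun i => (g i).right) i₀) (𝟙 U) (by
        simp only [Over.mk_hom, Category.assoc, Limits.Sigma.ι_map, toUnit_comp_eq]
        exact (Category.id_comp _).symm)
    refine ⟨b, hb₂, ?_⟩
    rw [← Category.assoc, hb₁]
    exact (Category.assoc _ _ _).trans
      (congrArg (fun t => y ≫ t) ((Limits.Sigma.ι_desc _ _).trans hd₀))

end FibredCoproduct

/-- The same configuration as in the enriched case, with `U = Δ[1]`. The second coordinate `e` comes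
from the identity of `Δ[1]` on the summand of `Λ[1, 0]`, extended so as to stay constant at `0` on
the domain of the reindexed map. -/
theorem not_definable_fibredCoproduct :
    ¬ (liftingNotion (fibredCoproduct hornInclusion.{w})).Definable := by
  obtain ⟨σ, e, he, hb⟩ := exists_fibredCoproduct hornInclusion.{w} ⟨0, 0⟩ (Δ[1] : SSet.{w})
    (vertex 0 _) (𝟙 Δ[1]) horn_one_ι
  obtain ⟨b₀, hb₀, hb₀'⟩ := hb (vertex 0 Δ[1])
  obtain ⟨b₁, hb₁, hb₁'⟩ := hb (vertex 1 Δ[1])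
  have hm : IsCartesianMono (reindex (fibredCoproductHom hornInclusion.{w})) :=
    isCartesianMono_fibredCoproduct _ mono_hornInclusion
  refine (reindex.fibreProjection (fibredCoproductHom hornInclusion.{w})).not_definable hm
    (Over.mk σ) (lift (reindex.rightSnd _ _) e) ?_ b₀ b₁ (hb₀.trans hb₁.symm) ?_ ?_
  · rw [lift_snd, he, comp_vertex]
  · rw [comp_lift]
    exact congrArg₂ lift hb₀ (hb₀'.trans (Category.comp_id _))
  · rw [comp_lift]
    exact congrArg₂ lift hb₁ (hb₁'.trans (Category.comp_id _))

end Horns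

end Definability

theorem mainTheorem3 :
    (∀ (C : Type u) [Category.{v} C] [CartesianMonoidalCategory C] [MonoidalClosed C]
      [HasFiniteLimits C] [HasFiniteColimits C] [HasSubobjectClassifier C]
      (𝕀 : LinearInterval C), 𝕀.NonTrivial →
        ∃ s t : 𝕀.KanStructure 𝕀.Z, s ≠ t ∧
          s.reindex 𝕀.T₀ = t.reindex 𝕀.T₀ ∧ s.reindex 𝕀.T₁ = t.reindex 𝕀.T₁) ∧
    ¬ (liftingNotion (kanMaps endpoint.{w} (genericMono SSet.{w}))).Definable ∧
    ¬ (liftingNotion (kanMaps endpoint.{w} genericDecidableMono.{w})).Definable ∧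
    ¬ (liftingNotion
        (kanMaps endpoint.{w} (setFamily subobjectsOfRepresentables.{w}))).Definable ∧
    ¬ (liftingNotion (kanMaps endpoint.{w} (setFamily boundaryInclusion.{w}))).Definable ∧
    ¬ (liftingNotion (fibredCoproduct hornInclusion.{w})).Definable ∧
    ¬ (liftingNotion (enrichedMaps hornInclusion.{w})).Definable :=
  ⟨fun _ _ _ _ _ _ _ 𝕀 h => 𝕀.exists_kanStructure h, not_definable_genericMono,
    not_definable_genericDecidableMono, not_definable_subobjectsOfRepresentables,
    not_definable_boundaryInclusion, not_definable_fibredCoproduct, not_definable_enrichedMaps⟩
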